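/- An instance of the prize-collecting vertex-disjoint multi-paths problem consists of a finite vertex set $V$, an integer $m$ with $1\le m\le |V|$, a nonnegative edge weight function $w$ on the complete graph on $V$ satisfying the triangle inequality, and a penalty function $\pi:V\to\mathbb{R}_{\ge 0}$. A feasible solution is a set $\mathcal{T}$ of $m$ pairwise vertex-disjoint paths (a single vertex counts as a path); let $V(\mathcal T)$ be the set of vertices on these paths, $w(\mathcal{T})$ the total weight of their edges, and $\pi(V\setminus V(\mathcal{T}))=\sum_{v\in V\setminus V(\mathcal{T})}\pi(v)$. Let $opt$ be the minimum of $w(\mathcal{T})+\pi(V\setminus V(\mathcal{T}))$ over all feasible solutions. For a real number $r\ge 1$, an algorithm is called an $r$-LMP (Lagrangian multiplier preserving algorithm with factor $r$) if for every instance it outputs, in time polynomial in $|V|$, a feasible solution $\mathcal{T}$ with $$w(\mathcal{T})+r\cdot\pi(V\setminus V(\mathcal{T}))\le r\cdot opt .$$ Theorem. The prize-collecting vertex-disjoint multi-paths problem admits a $4$-LMP algorithm that runs in time $O(|V|^4)$, where the implied constant depends on nothing, in particular not on $m$, $w$ or $\pi$. Time is counted on a real RAM in which each of the following takes one step: additions,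 subtractions and comparisons of natural numbers and of real numbers, multiplication of a real number by a rational constant of the program, indexed memory access, assignment and branching. -/

import Mathlib

namespace PrizeCollecting

/-! ## The prize-collecting vertex-disjoint `m`-paths problem -/

/-- An instance: the complete graph on `V` with an edge weight function that is a (pseudo-)metric,
and a penalty function on the vertices. Zero weights and zero penalties are allowed. The weight is
a function on unordered pairs; the loops, which are not edges, carry the value `0`. -/
structure Inst (V : Type*) where
  w : Sym2 V → ℝ
  w_nonneg : ∀ e, 0 ≤ w e
  w_self : ∀ u, w s(u, u) = 0
  w_triangle : ∀ u v x, w s(u, x) ≤ w s(u, v) + w s(v, x)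
  penalty : V → ℝ
  penalty_nonneg : ∀ v, 0 ≤ penalty v

/-- A path of the complete graph on `V`, with arbitrary end vertices (possibly a single vertex). -/
structure PathIn (V : Type*) where
  source : V
  target : V
  walk : (⊤ : SimpleGraph V).Walk source target
  isPath : walk.IsPath

/-- The vertices of a path, in the order in which they are visited. -/
def PathIn.verts {V : Type*} (P : PathIn V) : List V := P.walk.support

/-- A feasible solution: `m` pairwise vertex-disjoint paths. -/
structure PathFamily (V : Type*) (m : ℕ) where
  path : Fin m → PathIn V
  disjoint : ∀ i j, i ≠ j → (path i).verts.Disjoint (path j).verts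

section Cost

variable {V : Type*} {m : ℕ}

/-- `w(P)`, the sum of the weights of the edges of `P`. -/
def Inst.pathWeight (I : Inst V) (P : PathIn V) : ℝ := (P.walk.edges.map I.w).sum

/-- `w(𝒯)`, the sum of the weights of the paths of `𝒯`. -/
def Inst.weight (I : Inst V) (T : PathFamily V m) : ℝ := ∑ i, I.pathWeight (T.path i)

/-- The vertices spanned by `𝒯`. -/
def PathFamily.spanned (T : PathFamily V m) : Set V := {v | ∃ i, v ∈ (T.path i).verts}

open Classical in
/-- `π(V ∖ V(𝒯))`, the total penalty of the vertices that are not spanned by `𝒯`. -/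
noncomputable def Inst.uncovered [Fintype V] (I : Inst V) (T : PathFamily V m) : ℝ :=
  ∑ v with v ∉ T.spanned, I.penalty v

/-- The objective `w(𝒯) + π(V ∖ V(𝒯))`. -/
noncomputable def Inst.cost [Fintype V] (I : Inst V) (T : PathFamily V m) : ℝ :=
  I.weight T + I.uncovered T

/-- The optimal value over all families of `m` vertex-disjoint paths. -/
noncomputable def Inst.opt [Fintype V] (I : Inst V) (m : ℕ) : ℝ :=
  sInf (Set.range fun T : PathFamily V m => I.cost T)

end Cost

/-- There are finitely many families of paths. -/
theorem finite_pathFamily (V : Type*) [Fintype V] (m : ℕ) : Finite (PathFamily V m) := by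
  classical
  have h1 : Finite (PathIn V) := by
    refine Finite.of_injective
      (β := Σ u : V, Σ v : V, (⊤ : SimpleGraph V).Path u v)
      (fun P => ⟨P.source, P.target, P.walk, P.isPath⟩) ?_
    rintro ⟨a, b, p, hp⟩ ⟨c, d, q, hq⟩ h
    simp only [Sigma.mk.injEq] at h
    obtain ⟨rfl, h⟩ := h
    simp only [heq_eq_eq, Sigma.mk.injEq] at h
    obtain ⟨rfl, h⟩ := h
    simp only [heq_eq_eq, Subtype.mk.injEq] at h
    subst h
    rfl
  refine Finite.of_injective (fun T : PathFamily V m => T.path) ?_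
  rintro ⟨p, hp⟩ ⟨q, hq⟩ h
  simp only at h
  subst h
  rfl

/-- If `m ≤ |V|`, then `opt` is attained, so it is the minimum of the objective. -/
theorem isLeast_opt {V : Type*} [Fintype V] (I : Inst V) {m : ℕ} (hm : m ≤ Fintype.card V) :
    IsLeast (Set.range fun T : PathFamily V m => I.cost T) (I.opt m) := by
  have := finite_pathFamily V m
  have hf : (Set.range fun T : PathFamily V m => I.cost T).Finite := Set.finite_range _
  have e : Fin m ↪ V := (Fin.castLEEmb hm).trans (Fintype.equivFin V).symm.toEmbedding
  have hne : (Set.range fun T : PathFamily V m => I.cost T).Nonempty := by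
    refine ⟨_, ⟨⟨fun i => ⟨e i, e i, .nil, by simp⟩, ?_⟩, rfl⟩⟩
    intro i j hij
    have : e i ≠ e j := fun h => hij (e.injective h)
    simp [PathIn.verts, this.symm]
  exact ⟨hne.csInf_mem hf, fun x hx => csInf_le hf.bddBelow hx⟩

/-! ## The machine model

A real RAM with natural-number registers and real registers, and with arrays of either kind that
are addressed by natural numbers. Every arithmetic operation, comparison, memory access, assignment
and branch costs one step. The arithmetic is additive: naturals are added and subtracted, reals are
added, subtracted and multiplied by rational constants of the program. So the machine can neither
round reals to integers nor square numbers repeatedly, and it is weaker than the usual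
unit-cost real RAM with multiplication and division. -/

/-- The contents of the memory; `iarr a` and `rarr a` are the arrays with name `a`. -/
structure Mem where
  ivar : ℕ → ℕ
  iarr : ℕ → ℕ → ℕ
  rvar : ℕ → ℝ
  rarr : ℕ → ℕ → ℝ

/-- Natural-number expressions. -/
inductive NExpr
  | const (k : ℕ)
  | var (x : ℕ)
  | get (a : ℕ) (i : NExpr)
  | add (e₁ e₂ : NExpr)
  | sub (e₁ e₂ : NExpr)

/-- Real expressions. -/
inductive RExpr
  | const (q : ℚ)
  | var (x : ℕ)
  | get (a : ℕ) (i : NExpr)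
  | add (e₁ e₂ : RExpr)
  | sub (e₁ e₂ : RExpr)
  | smul (q : ℚ) (e : RExpr)

/-- Tests. -/
inductive BExpr
  | natLe (e₁ e₂ : NExpr)
  | realLe (e₁ e₂ : RExpr)
  | not (b : BExpr)
  | and (b₁ b₂ : BExpr)

/-- Programs. -/
inductive Cmd
  | skip
  | setN (x : ℕ) (e : NExpr)
  | setR (x : ℕ) (e : RExpr)
  | putN (a : ℕ) (i : NExpr) (e : NExpr)
  | putR (a : ℕ) (i : NExpr) (e : RExpr)
  | seq (c₁ c₂ : Cmd)
  | ite (b : BExpr) (c₁ c₂ : Cmd)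
  | while (b : BExpr) (c : Cmd)

/-- The value of an expression (subtraction of naturals is truncated at `0`). -/
def NExpr.eval (s : Mem) : NExpr → ℕ
  | const k => k
  | var x => s.ivar x
  | get a i => s.iarr a (i.eval s)
  | add e₁ e₂ => e₁.eval s + e₂.eval s
  | sub e₁ e₂ => e₁.eval s - e₂.eval s

/-- The number of steps needed to evaluate an expression. -/
def NExpr.cost : NExpr → ℕ
  | const _ => 1
  | var _ => 1
  | get _ i => i.cost + 1
  | add e₁ e₂ => e₁.cost + e₂.cost + 1
  | sub e₁ e₂ => e₁.cost + e₂.cost + 1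

/-- The value of a real expression. -/
noncomputable def RExpr.eval (s : Mem) : RExpr → ℝ
  | const q => (q : ℝ)
  | var x => s.rvar x
  | get a i => s.rarr a (i.eval s)
  | add e₁ e₂ => e₁.eval s + e₂.eval s
  | sub e₁ e₂ => e₁.eval s - e₂.eval s
  | smul q e => (q : ℝ) * e.eval s

/-- The number of steps needed to evaluate a real expression. -/
def RExpr.cost : RExpr → ℕ
  | const _ => 1
  | var _ => 1
  | get _ i => i.cost + 1
  | add e₁ e₂ => e₁.cost + e₂.cost + 1
  | sub e₁ e₂ => e₁.cost + e₂.cost + 1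
  | smul _ e => e.cost + 1

/-- The truth of a test. -/
def BExpr.Holds (s : Mem) : BExpr → Prop
  | natLe e₁ e₂ => e₁.eval s ≤ e₂.eval s
  | realLe e₁ e₂ => e₁.eval s ≤ e₂.eval s
  | not b => ¬ b.Holds s
  | and b₁ b₂ => b₁.Holds s ∧ b₂.Holds s

/-- The number of steps needed to evaluate a test. -/
def BExpr.cost : BExpr → ℕ
  | natLe e₁ e₂ => e₁.cost + e₂.cost + 1
  | realLe e₁ e₂ => e₁.cost + e₂.cost + 1
  | not b => b.cost + 1
  | and b₁ b₂ => b₁.cost + b₂.cost + 1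

/-- Write `v` into the natural-number register `x`. -/
def Mem.setN (s : Mem) (x v : ℕ) : Mem := { s with ivar := Function.update s.ivar x v }

/-- Write `v` into the real register `x`. -/
noncomputable def Mem.setR (s : Mem) (x : ℕ) (v : ℝ) : Mem :=
  { s with rvar := Function.update s.rvar x v }

/-- Write `v` into cell `i` of the natural-number array `a`. -/
def Mem.putN (s : Mem) (a i v : ℕ) : Mem :=
  { s with iarr := Function.update s.iarr a (Function.update (s.iarr a) i v) }

/-- Write `v` into cell `i` of the real array `a`. -/
noncomputable def Mem.putR (s : Mem) (a i : ℕ) (v : ℝ) : Mem :=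
  { s with rarr := Function.update s.rarr a (Function.update (s.rarr a) i v) }

/-- `Exec c s t s'`: started with memory `s`, the program `c` halts after exactly `t` steps with
memory `s'`. -/
inductive Exec : Cmd → Mem → ℕ → Mem → Prop
  | skip (s : Mem) : Exec .skip s 1 s
  | setN (s : Mem) (x : ℕ) (e : NExpr) :
      Exec (.setN x e) s (e.cost + 1) (s.setN x (e.eval s))
  | setR (s : Mem) (x : ℕ) (e : RExpr) :
      Exec (.setR x e) s (e.cost + 1) (s.setR x (e.eval s))
  | putN (s : Mem) (a : ℕ) (i e : NExpr) :
      Exec (.putN a i e) s (i.cost + e.cost + 1) (s.putN a (i.eval s) (e.eval s))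
  | putR (s : Mem) (a : ℕ) (i : NExpr) (e : RExpr) :
      Exec (.putR a i e) s (i.cost + e.cost + 1) (s.putR a (i.eval s) (e.eval s))
  | seq {c₁ c₂ : Cmd} {s s₁ s₂ : Mem} {t₁ t₂ : ℕ} :
      Exec c₁ s t₁ s₁ → Exec c₂ s₁ t₂ s₂ → Exec (.seq c₁ c₂) s (t₁ + t₂) s₂
  | iteTrue {b : BExpr} {c₁ c₂ : Cmd} {s s' : Mem} {t : ℕ} :
      b.Holds s → Exec c₁ s t s' → Exec (.ite b c₁ c₂) s (b.cost + 1 + t) s'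
  | iteFalse {b : BExpr} {c₁ c₂ : Cmd} {s s' : Mem} {t : ℕ} :
      ¬ b.Holds s → Exec c₂ s t s' → Exec (.ite b c₁ c₂) s (b.cost + 1 + t) s'
  | whileFalse {b : BExpr} {c : Cmd} {s : Mem} :
      ¬ b.Holds s → Exec (.while b c) s (b.cost + 1) s
  | whileTrue {b : BExpr} {c : Cmd} {s s₁ s₂ : Mem} {t₁ t₂ : ℕ} :
      b.Holds s → Exec c s t₁ s₁ → Exec (.while b c) s₁ t₂ s₂ →
      Exec (.while b c) s (b.cost + 1 + t₁ + t₂) s₂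

/-- The machine is deterministic: a run has only one running time and one final memory. -/
theorem Exec.det {c : Cmd} {s s' s'' : Mem} {t t' : ℕ} (h : Exec c s t s') (h' : Exec c s t' s'') :
    t = t' ∧ s' = s'' := by
  induction h generalizing t' s'' with
  | skip | setN | setR | putN | putR => cases h'; exact ⟨rfl, rfl⟩
  | seq _ _ ih₁ ih₂ =>
    cases h' with
    | seq k₁ k₂ =>
      obtain ⟨rfl, rfl⟩ := ih₁ k₁
      obtain ⟨rfl, rfl⟩ := ih₂ k₂
      exact ⟨rfl, rfl⟩
  | iteTrue hb _ ih =>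
    cases h' with
    | iteTrue _ k => obtain ⟨rfl, rfl⟩ := ih k; exact ⟨rfl, rfl⟩
    | iteFalse hn _ => exact absurd hb hn
  | iteFalse hb _ ih =>
    cases h' with
    | iteTrue hn _ => exact absurd hn hb
    | iteFalse _ k => obtain ⟨rfl, rfl⟩ := ih k; exact ⟨rfl, rfl⟩
  | whileFalse hb =>
    cases h' with
    | whileFalse _ => exact ⟨rfl, rfl⟩
    | whileTrue hn _ _ => exact absurd hn hb
  | whileTrue hb _ _ ih₁ ih₂ =>
    cases h' with
    | whileFalse hn => exact absurd hb hn
    | whileTrue _ k₁ k₂ =>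
      obtain ⟨rfl, rfl⟩ := ih₁ k₁
      obtain ⟨rfl, rfl⟩ := ih₂ k₂
      exact ⟨rfl, rfl⟩

/-! ## Algorithms for the problem -/

/-- The input. Register `0` holds `n = |V|`, register `1` holds `m`, cell `i * n + j` of the real
array `0` holds the weight of the edge `ij`, and cell `i` of the real array `1` holds the penalty of
vertex `i`. Everything else is `0`. -/
noncomputable def loadMem {n : ℕ} (I : Inst (Fin n)) (m : ℕ) : Mem where
  ivar x := if x = 0 then n else if x = 1 then m else 0
  iarr _ _ := 0
  rvar _ := 0
  rarr a k :=
    if a = 0 then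
      if h : k < n * n then I.w s(Fin.divNat ⟨k, h⟩, Fin.modNat ⟨k, h⟩) else 0
    else if a = 1 then
      if h : k < n then I.penalty ⟨k, h⟩ else 0
    else 0

/-- The output. Cell `j` of the natural-number array `0` holds the number of vertices of the path
with index `j`, whose `i`-th vertex is found in cell `j * n + i` of the natural-number array `1`. -/
def Outputs {n m : ℕ} (s : Mem) (T : PathFamily (Fin n) m) : Prop :=
  ∀ j : Fin m, (T.path j).verts.map Fin.val =
    (List.range (s.iarr 0 j)).map fun i => s.iarr 1 (j * n + i)

/-- On the instance `I` of the problem with `m` paths, the program `A` halts after exactly `t` steps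
with output `T`. -/
def Computes (A : Cmd) {n m : ℕ} (I : Inst (Fin n)) (t : ℕ) (T : PathFamily (Fin n) m) : Prop :=
  ∃ s, Exec A (loadMem I m) t s ∧ Outputs s T

/-- `A` is an `r`-LMP algorithm: in polynomial time it outputs, for every instance, `m`
vertex-disjoint paths `𝒯` with `w(𝒯) + r · π(V ∖ V(𝒯)) ≤ r · opt`. The number `m` of paths, with
`1 ≤ m ≤ |V|`, is part of the input. -/
def IsLMP (r : ℝ) (A : Cmd) : Prop :=
  ∃ p : Polynomial ℕ, ∀ (n m : ℕ), 1 ≤ m → m ≤ n → ∀ I : Inst (Fin n),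
    ∃ (t : ℕ) (T : PathFamily (Fin n) m), Computes A I t T ∧ t ≤ p.eval n ∧
      I.weight T + r * I.uncovered T ≤ r * I.opt m

/-- The running time of `A` on instances with `n` vertices is `O(f n)`, with a constant that
depends neither on the number of paths nor on the weights and penalties. -/
def RunsInTime (A : Cmd) (f : ℕ → ℕ) : Prop :=
  ∃ C : ℕ, ∀ (n m : ℕ), 1 ≤ m → m ≤ n → ∀ I : Inst (Fin n),
    ∃ (t : ℕ) (s : Mem), Exec A (loadMem I m) t s ∧ t ≤ C * f n

end PrizeCollecting

namespace PrizeCollecting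

open Finset

set_option linter.unusedSectionVars false

/-! ## Moat growing -/

/-! The argument is primal-dual. Every vertex starts as an active component. Active components grow
at unit rate, merge with the components they meet, and become inactive once their penalties are used
up. Growth stops when exactly `m` components are active.

Lower bound: while `k` components are active, growth by `δ` raises a bound `y` by `δ * (k - m)`.
Each of the `m` paths of a solution pays `δ` for every active component it visits except one, and
every active component that is missed pays `δ` out of its penalty. Hence `y ≤ opt`; see
`walkPaid_grow`, `lower_grow`, `lower_merge`, `lower_le_cost` and `Hist.le_lower`.

Upper bound: the run is read backwards, starting from the `m` final components and no edges. Undoing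
a merge keeps its tight edge unless the merged component is already dropped, or the absorbed part
was inactive and meets no kept edge. So there are always `m` fewer kept edges than kept components,
and kept inactive components have degree at least 2. Counting degrees shows that undoing growth by
`δ` costs at most `2 * δ * (k - m)` in edge weight plus twice the dropped penalty. In total `w(F) +
2π ≤ 2y`; see `Tail` and `Tail.bound_of_grow`.

Tours: the kept edges are doubled and shortcut. A system of tours is a permutation; adding an edge
multiplies it by a transposition, which joins two cycles (`SameCycle.swap_mul`) and costs at most
twice the edge (`sum_mul_swap_le`). Opening the `m` cycles through the final labels gives paths with
`w + 4π ≤ 4y` (`Tail.exists_family`).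

Time: there are at most `2n` events, each found by scanning all pairs of vertices, and pruning and
output are quadratic. The program is verified with the rules for `wp`; `Hist` records the run as a
purely mathematical object from which both bounds are read off. -/

/-- A state of the moat growing process: `lab x` is the label of the component of `x`, `act` holds
the labels of the active components, `d x` is the total growth around `x`, and `p c` is the
residual penalty of the component with label `c`. -/
structure Moat (V : Type*) where
  lab : V → V
  act : Finset V
  d : V → ℝ
  p : V → ℝ

namespace Moat

variable {V : Type*} [DecidableEq V]

/-- Every vertex is an active component. -/
def init [Fintype V] (I : Inst V) : Moat V := ⟨id, univ, 0, I.penalty⟩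

/-- All active components grow by `δ`. -/
def grow (s : Moat V) (δ : ℝ) : Moat V where
  lab := s.lab
  act := s.act
  d x := if s.lab x ∈ s.act then s.d x + δ else s.d x
  p c := if c ∈ s.act then s.p c - δ else s.p c

/-- The component with label `c` becomes inactive. -/
def kill (s : Moat V) (c : V) : Moat V := { s with act := s.act.erase c }

/-- The component of `v` is merged into the component of `u`. -/
def merge (s : Moat V) (u v : V) : Moat V where
  lab x := if s.lab x = s.lab v then s.lab u else s.lab x
  act := s.act.erase (s.lab v)
  d := s.d
  p := Function.update s.p (s.lab u) (s.p (s.lab u) + s.p (s.lab v))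

/-- The invariants of moat growing. -/
structure Good (I : Inst V) (s : Moat V) : Prop where
  idem : ∀ x, s.lab (s.lab x) = s.lab x
  lab_act : ∀ c ∈ s.act, s.lab c = c
  d_le : ∀ u v, s.lab u ≠ s.lab v → s.d u + s.d v ≤ I.w s(u, v)
  p_nonneg : ∀ c, s.lab c = c → 0 ≤ s.p c
  p_eq_zero : ∀ c, s.lab c = c → c ∉ s.act → s.p c = 0

theorem good_init [Fintype V] (I : Inst V) : (init I).Good I where
  idem _ := rfl
  lab_act _ _ := rfl
  d_le u v _ := by simpa [init] using I.w_nonneg _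
  p_nonneg c _ := I.penalty_nonneg c
  p_eq_zero c _ h := absurd (mem_univ c) h

theorem Good.kill {I : Inst V} {s : Moat V} (h : s.Good I) {c : V} (hc : s.p c = 0) :
    (s.kill c).Good I where
  idem := h.idem
  lab_act b hb := h.lab_act b (mem_of_mem_erase hb)
  d_le := h.d_le
  p_nonneg := h.p_nonneg
  p_eq_zero b hb hb' := by
    by_cases e : b = c
    · subst e; exact hc
    · exact h.p_eq_zero b hb fun hm => hb' (mem_erase.2 ⟨e, hm⟩)

/-- The slack of an edge between two active components shrinks at rate two, between an active and an
inactive one at rate one, and between inactive ones not at all. -/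
theorem Good.grow {I : Inst V} {s : Moat V} (h : s.Good I) {δ : ℝ}
    (hp : ∀ c ∈ s.act, δ ≤ s.p c)
    (h₁ : ∀ u v, s.lab u ≠ s.lab v → s.lab u ∈ s.act → s.lab v ∉ s.act →
      δ ≤ I.w s(u, v) - s.d u - s.d v)
    (h₂ : ∀ u v, s.lab u ≠ s.lab v → s.lab u ∈ s.act → s.lab v ∈ s.act →
      2 * δ ≤ I.w s(u, v) - s.d u - s.d v) :
    (s.grow δ).Good I where
  idem := h.idem
  lab_act := h.lab_act
  d_le u v huv := by
    change s.lab u ≠ s.lab v at huv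
    have h0 := h.d_le u v huv
    simp only [Moat.grow]
    split_ifs with hu hv hv
    · have := h₂ u v huv hu hv; linarith
    · have := h₁ u v huv hu hv; linarith
    · have := h₁ v u huv.symm hv hu; rw [Sym2.eq_swap] at this; linarith
    · exact h0
  p_nonneg c hc := by
    simp only [Moat.grow]
    split_ifs with hc'
    · linarith [hp c hc']
    · exact h.p_nonneg c hc
  p_eq_zero c hc hc' := by
    change c ∉ s.act at hc'
    simpa [Moat.grow, hc'] using h.p_eq_zero c hc hc'

theorem merge_lab_eq_self {I : Inst V} {s : Moat V} (h : s.Good I) {u v : V}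
    (huv : s.lab u ≠ s.lab v) {c : V} :
    (s.merge u v).lab c = c ↔ s.lab c = c ∧ c ≠ s.lab v := by
  simp only [merge]
  split_ifs with hc
  · constructor
    · rintro rfl
      rw [h.idem] at hc
      exact absurd hc huv
    · rintro ⟨h1, h2⟩
      exact absurd (h1.symm.trans hc) h2
  · constructor
    · intro h1
      exact ⟨h1, fun h2 => hc (by rw [h2, h.idem])⟩
    · exact fun h1 => h1.1

/-- Fewer pairs lie in different components afterwards, so the packing condition only weakens. The
surviving label is active by `hu`, so no inactive label inherits a positive residual penalty. -/
theorem Good.merge {I : Inst V} {s : Moat V} (h : s.Good I) {u v : V}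
    (huv : s.lab u ≠ s.lab v) (hu : s.lab u ∈ s.act) : (s.merge u v).Good I where
  idem x := by
    rw [merge_lab_eq_self h huv]
    simp only [Moat.merge]
    split_ifs with hx
    · exact ⟨h.idem u, huv⟩
    · exact ⟨h.idem x, hx⟩
  lab_act c hc := by
    rw [merge_lab_eq_self h huv]
    obtain ⟨h1, h2⟩ := mem_erase.1 hc
    exact ⟨h.lab_act c h2, h1⟩
  d_le x y hxy := h.d_le x y fun e => hxy (by simp [Moat.merge, e])
  p_nonneg c hc := by
    rw [merge_lab_eq_self h huv] at hc
    by_cases e : c = s.lab u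
    · subst e
      simpa [Moat.merge] using
        add_nonneg (h.p_nonneg _ (h.idem u)) (h.p_nonneg _ (h.idem v))
    · simpa [Moat.merge, e] using h.p_nonneg c hc.1
  p_eq_zero c hc hc' := by
    rw [merge_lab_eq_self h huv] at hc
    have h1 : c ∉ s.act := fun hm => hc' (mem_erase.2 ⟨hc.2, hm⟩)
    have e : c ≠ s.lab u := fun e => h1 (e ▸ hu)
    simpa [Moat.merge, e] using h.p_eq_zero c hc.1 h1

/-! ### The lower bound on the objective -/

/-- The part of the weight of the edge `uv` that has been paid for by growing. -/
def edgePaid (I : Inst V) (s : Moat V) (u v : V) : ℝ :=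
  if s.lab u = s.lab v then I.w s(u, v) else s.d u + s.d v

/-- The part of the weight of a walk that has been paid for by growing. -/
def walkPaid (I : Inst V) (s : Moat V) {x y : V} (q : (⊤ : SimpleGraph V).Walk x y) : ℝ :=
  (q.darts.map fun e => s.edgePaid I e.fst e.snd).sum

theorem walkPaid_nil (I : Inst V) (s : Moat V) (x : V) :
    s.walkPaid I (.nil : (⊤ : SimpleGraph V).Walk x x) = 0 := by
  simp [walkPaid]

theorem walkPaid_cons (I : Inst V) (s : Moat V) {x y z : V} (h : (⊤ : SimpleGraph V).Adj x y)
    (q : (⊤ : SimpleGraph V).Walk y z) :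
    s.walkPaid I (.cons h q) = s.edgePaid I x y + s.walkPaid I q := by
  simp [walkPaid]

theorem walkPaid_mono {I : Inst V} {s s' : Moat V}
    (h : ∀ u v, s.edgePaid I u v ≤ s'.edgePaid I u v) {x y : V}
    (q : (⊤ : SimpleGraph V).Walk x y) : s.walkPaid I q ≤ s'.walkPaid I q :=
  List.sum_le_sum fun _ _ => h _ _

theorem walkPaid_le {I : Inst V} {s : Moat V} (h : s.Good I) {x y : V}
    (q : (⊤ : SimpleGraph V).Walk x y) : s.walkPaid I q ≤ (q.edges.map I.w).sum := by
  rw [SimpleGraph.Walk.edges, List.map_map]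
  refine List.sum_le_sum fun e _ => ?_
  simp only [edgePaid]
  split_ifs with he
  · exact le_rfl
  · exact h.d_le _ _ he

/-- A walk that visits `k` active components is paid for `k - 1` times the growth. -/
theorem walkPaid_grow (I : Inst V) (s : Moat V) {δ : ℝ} (hδ : 0 ≤ δ) {x y : V}
    (q : (⊤ : SimpleGraph V).Walk x y) :
    s.walkPaid I q + δ * ((((q.support.map s.lab).toFinset ∩ s.act).card : ℝ) - 1) ≤
      (s.grow δ).walkPaid I q := by
  induction q with
  | @nil a =>
    have : (((({s.lab a} : Finset V) ∩ s.act).card : ℝ)) ≤ 1 := by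
      exact_mod_cast (card_le_card inter_subset_left).trans (card_singleton _).le
    simp [walkPaid_nil]
    nlinarith
  | @cons u v z h q ih =>
    rw [walkPaid_cons, walkPaid_cons]
    set A := (q.support.map s.lab).toFinset with hA
    have hv : s.lab v ∈ A := by
      simp only [hA, List.mem_toFinset, List.mem_map]
      exact ⟨v, q.start_mem_support, rfl⟩
    have e1 : ((SimpleGraph.Walk.cons h q).support.map s.lab).toFinset = insert (s.lab u) A := by
      simp [hA]
    rw [e1]
    -- Prepending `u` raises the count by at most one, and only if `uv` crosses between components
    -- and the component of `u` is growing; then `uv` itself is paid at least `δ` more.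
    suffices hs : s.edgePaid I u v +
        δ * (((insert (s.lab u) A ∩ s.act).card : ℝ) - ((A ∩ s.act).card : ℝ)) ≤
        (s.grow δ).edgePaid I u v by nlinarith
    by_cases huv : s.lab u = s.lab v
    · have : insert (s.lab u) A = A := insert_eq_self.2 (huv ▸ hv)
      rw [this]
      simp [edgePaid, grow, huv]
    · by_cases hu : s.lab u ∈ s.act
      · have hc : ((insert (s.lab u) A ∩ s.act).card : ℝ) ≤ ((A ∩ s.act).card : ℝ) + 1 := by
          rw [insert_inter_of_mem hu]
          exact_mod_cast card_insert_le _ _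
        simp only [edgePaid, grow, huv, hu, if_true, if_false]
        split_ifs <;> nlinarith
      · rw [insert_inter_of_notMem hu]
        simp only [edgePaid, grow, huv, hu, if_false]
        split_ifs <;> linarith

variable [Fintype V] {m : ℕ}

open Classical in
/-- The labels of the components that contain no vertex of `T`. -/
noncomputable def missed (s : Moat V) (T : PathFamily V m) : Finset V :=
  {c | s.lab c = c ∧ ∀ x ∈ T.spanned, s.lab x ≠ c}

theorem mem_missed {s : Moat V} {T : PathFamily V m} {c : V} :
    c ∈ s.missed T ↔ s.lab c = c ∧ ∀ x ∈ T.spanned, s.lab x ≠ c := by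
  classical
  simp [missed]

/-- A lower bound on the objective of `T`, paid for by growing. -/
noncomputable def lower (I : Inst V) (s : Moat V) (T : PathFamily V m) : ℝ :=
  ∑ i, s.walkPaid I (T.path i).walk + I.uncovered T - ∑ c ∈ s.missed T, s.p c

/-- The initial components are single vertices with their full penalties, so the residual penalties
of the missed components cancel the uncovered penalty exactly. -/
theorem lower_init (I : Inst V) (T : PathFamily V m) : 0 ≤ (init I).lower I T := by
  have h1 : 0 ≤ ∑ i, (init I).walkPaid I (T.path i).walk := by
    refine sum_nonneg fun i _ => List.sum_nonneg ?_
    simp only [List.mem_map]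
    rintro _ ⟨e, -, rfl⟩
    rw [edgePaid]
    split_ifs
    · exact I.w_nonneg _
    · exact (add_zero (0 : ℝ)).ge
  have h2 : I.uncovered T = ∑ c ∈ (init I).missed T, (init I).p c := by
    rw [Inst.uncovered]
    refine sum_congr ?_ fun _ _ => rfl
    ext c
    simp only [mem_filter, mem_univ, true_and, mem_missed, init, id]
    exact ⟨fun h x hx e => h (e ▸ hx), fun h hc => h c hc rfl⟩
  rw [lower, h2]
  linarith

/-- Every active component is missed or visited by some path. Each missed one releases `δ` of
penalty; the paths gain `δ` per visit, less one `δ` for each of the `m` paths. Components visited by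
several paths are merely counted more often. -/
theorem lower_grow {I : Inst V} {s : Moat V} (h : s.Good I) {δ : ℝ} (hδ : 0 ≤ δ)
    (T : PathFamily V m) :
    s.lower I T + δ * (s.act.card - m) ≤ (s.grow δ).lower I T := by
  have h1 := sum_le_sum fun (i : Fin m) (_ : i ∈ univ) =>
    s.walkPaid_grow I hδ (T.path i).walk
  rw [sum_add_distrib, ← mul_sum, sum_sub_distrib] at h1
  simp only [sum_const, card_univ, Fintype.card_fin, nsmul_eq_mul, mul_one] at h1
  have h2 : s.act.card ≤ (s.missed T ∩ s.act).card +
      ∑ i, (((T.path i).walk.support.map s.lab).toFinset ∩ s.act).card := by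
    have hsub : s.act ⊆ (s.missed T ∩ s.act) ∪
        univ.biUnion fun i => ((T.path i).walk.support.map s.lab).toFinset ∩ s.act := by
      intro c hc
      simp only [mem_union, mem_inter, mem_missed, mem_biUnion, mem_univ, true_and,
        List.mem_toFinset, List.mem_map, hc, and_true, h.lab_act c hc]
      by_contra hcon
      push Not at hcon
      obtain ⟨⟨x, ⟨i, hi⟩, hx⟩, h2⟩ := hcon
      exact h2 i x hi hx
    exact (card_le_card hsub).trans
      ((card_union_le _ _).trans (Nat.add_le_add_left card_biUnion_le _))
  have h3 : ∑ c ∈ (s.grow δ).missed T, (s.grow δ).p c =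
      ∑ c ∈ s.missed T, s.p c - δ * (s.missed T ∩ s.act).card := by
    have : (s.grow δ).missed T = s.missed T := rfl
    rw [this]
    have e : ∀ c, (s.grow δ).p c = s.p c - if c ∈ s.act then δ else 0 := by
      intro c
      simp only [grow]
      split_ifs <;> ring
    simp only [e, sum_sub_distrib, sum_ite_mem, sum_const, nsmul_eq_mul]
    ring
  have h4 : (s.act.card : ℝ) ≤ (s.missed T ∩ s.act).card +
      ∑ i, ((((T.path i).walk.support.map s.lab).toFinset ∩ s.act).card : ℝ) := by
    exact_mod_cast h2
  have h5 := mul_le_mul_of_nonneg_left h4 hδ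
  rw [lower, lower, h3]
  nlinarith

/-- Edges that become internal gain by `Good.d_le`. If the merged component is missed, both parts
were missed and their residual penalties add up; otherwise the set of missed components can only
shrink. -/
theorem lower_merge {I : Inst V} {s : Moat V} (h : s.Good I) {u v : V}
    (huv : s.lab u ≠ s.lab v) (T : PathFamily V m) :
    s.lower I T ≤ (s.merge u v).lower I T := by
  have h1 : ∑ i, s.walkPaid I (T.path i).walk ≤
      ∑ i, (s.merge u v).walkPaid I (T.path i).walk := by
    refine sum_le_sum fun i _ => walkPaid_mono (fun x y => ?_) _
    by_cases hxy : s.lab x = s.lab y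
    · simp [edgePaid, merge, hxy]
    · simp only [edgePaid, hxy, if_false]
      split_ifs
      · exact h.d_le x y hxy
      · exact le_rfl
  have h2 : ∑ c ∈ (s.merge u v).missed T, (s.merge u v).p c ≤ ∑ c ∈ s.missed T, s.p c := by
    by_cases hm : s.lab u ∈ (s.merge u v).missed T
    · have hu := mem_missed.1 hm
      have e : s.missed T = insert (s.lab v) ((s.merge u v).missed T) := by
        ext c
        rw [mem_insert, mem_missed, mem_missed, merge_lab_eq_self h huv]
        constructor
        · rintro ⟨hc, hc'⟩
          by_cases hcv : c = s.lab v
          · exact .inl hcv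
          · refine .inr ⟨⟨hc, hcv⟩, fun x hx hxc => ?_⟩
            simp only [merge] at hxc
            split_ifs at hxc with hxv
            · exact hu.2 x hx (by simp [merge, hxv])
            · exact hc' x hx hxc
        · rintro (rfl | ⟨⟨hc, hcv⟩, hc'⟩)
          · exact ⟨h.idem v, fun x hx hxv => hu.2 x hx (by simp [merge, hxv])⟩
          · refine ⟨hc, fun x hx hxc => hc' x hx ?_⟩
            simp [merge, hxc, hcv]
      have hnot : s.lab v ∉ (s.merge u v).missed T := by
        rw [mem_missed, merge_lab_eq_self h huv]
        exact fun hh => hh.1.2 rfl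
      rw [e, sum_insert hnot, ← add_sum_erase _ _ hm, ← add_sum_erase _ _ hm]
      have : ∑ x ∈ ((s.merge u v).missed T).erase (s.lab u), (s.merge u v).p x =
          ∑ x ∈ ((s.merge u v).missed T).erase (s.lab u), s.p x :=
        sum_congr rfl fun x hx => by simp [merge, (mem_erase.1 hx).1]
      rw [this]
      simp only [merge, Function.update_self]
      linarith
    · have hsub : (s.merge u v).missed T ⊆ s.missed T := by
        intro c hc
        have hcu : c ≠ s.lab u := fun e => hm (e ▸ hc)
        rw [mem_missed, merge_lab_eq_self h huv] at hc
        refine mem_missed.2 ⟨hc.1.1, fun x hx hxc => hc.2 x hx ?_⟩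
        simp [merge, hxc, hc.1.2]
      have e : ∑ c ∈ (s.merge u v).missed T, (s.merge u v).p c =
          ∑ c ∈ (s.merge u v).missed T, s.p c := by
        refine sum_congr rfl fun c hc => ?_
        have hcu : c ≠ s.lab u := fun e => hm (e ▸ hc)
        simp [merge, hcu]
      rw [e]
      exact sum_le_sum_of_subset_of_nonneg hsub fun c hc _ => h.p_nonneg c (mem_missed.1 hc).1
  rw [lower, lower]
  linarith

theorem lower_le_cost {I : Inst V} {s : Moat V} (h : s.Good I) (T : PathFamily V m) :
    s.lower I T ≤ I.cost T := by
  have h1 : ∑ i, s.walkPaid I (T.path i).walk ≤ I.weight T :=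
    sum_le_sum fun i _ => walkPaid_le h _
  have h2 : 0 ≤ ∑ c ∈ s.missed T, s.p c :=
    sum_nonneg fun c hc => h.p_nonneg c (mem_missed.1 hc).1
  rw [lower, Inst.cost]
  linarith

end Moat

/-! ### Merging cycles of a permutation -/

section Perm

open Equiv Equiv.Perm

variable {V : Type*} [DecidableEq V]

/-- Composing with the transposition of elements in different cycles joins these elements. -/
theorem sameCycle_swap_mul [Finite V] {τ : Perm V} {u v : V} (h : ¬ τ.SameCycle u v) :
    (swap u v * τ).SameCycle u v := by
  classical
  set σ := swap u v * τ with hσ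
  -- Until its first return to `u`, the `τ`-orbit of `u` avoids both `u` and `v`, so the
  -- transposition does not affect it. At the return time it is redirected to `v`.
  have key : ∀ i : ℕ, (∀ j, 1 ≤ j → j < i → (τ ^ j) u ≠ u) → ∀ j < i, (σ ^ j) u = (τ ^ j) u := by
    intro i hi j
    induction j with
    | zero => simp
    | succ j ih =>
      intro hj
      have e : (σ ^ (j + 1)) u = swap u v (τ ((τ ^ j) u)) := by
        rw [pow_succ', mul_apply, ih (by omega)]
        rfl
      rw [e, pow_succ' τ, mul_apply]
      refine swap_apply_of_ne_of_ne ?_ ?_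
      · have := hi (j + 1) (by omega) hj
        rwa [pow_succ', mul_apply] at this
      · intro e
        exact h ⟨j + 1, by rw [← e]; norm_cast; rw [pow_succ', mul_apply]⟩
  have hex : ∃ i : ℕ, 1 ≤ i ∧ (τ ^ i) u = u :=
    ⟨orderOf τ, (isOfFinOrder_of_finite τ).orderOf_pos, by simp [pow_orderOf_eq_one]⟩
  obtain ⟨h1, h2⟩ := Nat.find_spec hex
  set k := Nat.find hex with hk
  have hmin : ∀ j, 1 ≤ j → j < k → (τ ^ j) u ≠ u := fun j hj hjk e =>
    Nat.find_min hex hjk ⟨hj, e⟩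
  obtain ⟨i, hi⟩ : ∃ i, k = i + 1 := ⟨k - 1, by omega⟩
  have h3 := key k hmin i (by omega)
  refine ⟨(k : ℤ), ?_⟩
  rw [zpow_natCast, hi, pow_succ', mul_apply, h3, hσ, mul_apply, ← mul_apply τ, ← pow_succ', ← hi,
    h2, swap_apply_left]

/-- Composing with the transposition of elements in different cycles merges these two cycles. -/
theorem SameCycle.swap_mul [Finite V] {τ : Perm V} {u v : V} (h : ¬ τ.SameCycle u v) {x y : V}
    (hxy : τ.SameCycle x y) : (swap u v * τ).SameCycle x y := by
  have huv := sameCycle_swap_mul h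
  -- A single step of `τ` suffices. The transposition interferes only if `τ z` is `u` or `v`, and
  -- these two are already known to share a cycle.
  have step : ∀ z, (swap u v * τ).SameCycle z (τ z) := by
    intro z
    have h1 : (swap u v * τ).SameCycle z ((swap u v * τ) z) := sameCycle_apply_right.2 (.refl _ _)
    by_cases h2 : τ z = u
    · have h3 : (swap u v * τ) z = v := by simp [h2]
      rw [h3] at h1
      rw [h2]
      exact h1.trans huv.symm
    · by_cases h4 : τ z = v
      · have h3 : (swap u v * τ) z = u := by simp [h4]
        rw [h3] at h1
        rw [h4]
        exact h1.trans huv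
      · have h3 : (swap u v * τ) z = τ z := by
          rw [mul_apply]
          exact swap_apply_of_ne_of_ne h2 h4
        rwa [h3] at h1
  obtain ⟨i, hi⟩ := hxy.exists_nat_pow_eq
  subst hi
  clear hxy
  induction i with
  | zero => exact .refl _ _
  | succ i ih => rw [pow_succ', mul_apply]; exact ih.trans (step _)

/-- Merging two cycles costs at most twice the weight of the edge. -/
theorem sum_mul_swap_le [Fintype V] (I : Inst V) (σ : Perm V) {u v : V} (h : u ≠ v) :
    ∑ x, I.w s(x, (σ * swap u v) x) ≤ ∑ x, I.w s(x, σ x) + 2 * I.w s(u, v) := by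
  -- Reindexing moves the transposition to the other end of each edge. The detour through `x` then
  -- costs the displacement of `x`, which is `w(u, v)` for `u` and for `v`, and zero elsewhere.
  have e1 : ∑ x, I.w s(x, (σ * swap u v) x) = ∑ x, I.w s(swap u v x, σ x) := by
    rw [← Equiv.sum_comp (swap u v)]
    exact sum_congr rfl fun x _ => by simp
  have e2 : ∑ x, I.w s(swap u v x, x) = 2 * I.w s(u, v) := by
    rw [← sum_subset (subset_univ {u, v})]
    · rw [sum_pair h, swap_apply_left, swap_apply_right, Sym2.eq_swap]
      ring
    · intro x _ hx
      simp only [mem_insert, mem_singleton, not_or] at hx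
      rw [swap_apply_of_ne_of_ne hx.1 hx.2, I.w_self]
  rw [e1, ← e2, ← sum_add_distrib]
  exact sum_le_sum fun x _ => by linarith [I.w_triangle (swap u v x) x (σ x)]

end Perm

/-! ### Pruning: undoing the events in reverse order -/

namespace Moat

open Equiv

variable {V : Type*} [DecidableEq V]

/-- The number of edges of `F` that leave the component with label `c`, if no edge of `F` lies
within this component. -/
def deg (s : Moat V) (F : List (V × V)) (c : V) : ℕ :=
  (F.map fun e => (if s.lab e.1 = c then 1 else 0) + if s.lab e.2 = c then 1 else 0).sum

theorem deg_cons (s : Moat V) (u v : V) (F : List (V × V)) (c : V) :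
    s.deg ((u, v) :: F) c =
      (if s.lab u = c then 1 else 0) + (if s.lab v = c then 1 else 0) + s.deg F c := by
  simp [deg]

theorem deg_congr {s s' : Moat V} {c : V} (h : ∀ x, s.lab x = c ↔ s'.lab x = c)
    (F : List (V × V)) : s.deg F c = s'.deg F c := by
  simp [deg, h]

theorem one_le_deg {s : Moat V} {F : List (V × V)} {c : V} {e : V × V} (he : e ∈ F)
    (h : s.lab e.1 = c ∨ s.lab e.2 = c) : 1 ≤ s.deg F c := by
  refine le_trans ?_ (List.single_le_sum (by simp) _ (List.mem_map_of_mem he))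
  rcases h with h | h <;> simp [h]

/-- Double counting of the edge ends. -/
theorem sum_deg {s : Moat V} {F : List (V × V)} (A : Finset V) :
    ∑ c ∈ A, s.deg F c =
      (F.map fun e => (if s.lab e.1 ∈ A then 1 else 0) + if s.lab e.2 ∈ A then 1 else 0).sum := by
  induction F with
  | nil => simp [deg]
  | cons e F ih =>
    obtain ⟨u, v⟩ := e
    simp only [deg_cons, sum_add_distrib, ih, List.map_cons, List.sum_cons, sum_ite_eq]

variable [Fintype V]

/-- The labels that do not belong to `K`. -/
def dropped (s : Moat V) (K : Finset V) : Finset V := {c | s.lab c = c ∧ c ∉ K}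

theorem mem_dropped {s : Moat V} {K : Finset V} {c : V} :
    c ∈ s.dropped K ↔ s.lab c = c ∧ c ∉ K := by simp [dropped]

/-- The state of the pruning phase when all events after state `s` have been undone: `K` are the
labels of the components that are kept, `F` are the edges that are kept, `σ` is the corresponding
system of tours, `y` is the lower bound that was gained after `s`, and the moat growing process
ended with labels `labE` and active components `A`. -/
structure Tail (I : Inst V) (m : ℕ) (labE : V → V) (A : Finset V) (s : Moat V) (y : ℝ)
    (K : Finset V) (F : List (V × V)) (σ : Perm V) : Prop where
  lab_K : ∀ c ∈ K, s.lab c = c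
  A_sub : A ⊆ K
  labE_mem : ∀ x, s.lab x ∈ K → labE x ∈ A
  labE_congr : ∀ x x', s.lab x = s.lab x' → labE x = labE x'
  ends : ∀ e ∈ F, s.lab e.1 ∈ K ∧ s.lab e.2 ∈ K
  card_eq : F.length + m = K.card
  two_le_deg : ∀ c ∈ K, c ∉ s.act → 2 ≤ s.deg F c
  bound : (F.map fun e => I.w s(e.1, e.2) - s.d e.1 - s.d e.2).sum +
    2 * ∑ c ∈ s.dropped K, s.p c ≤ 2 * y
  tour : ∑ x, I.w s(x, σ x) ≤ 2 * (F.map fun e => I.w s(e.1, e.2)).sum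
  labE_apply : ∀ x, labE (σ x) = labE x
  -- The merges before `s` will put further transpositions to the right of `σ`. Here `τ` stands for
  -- their still unknown product and `K'` for the vertices finally kept; all that matters is that
  -- `τ` preserves the components of `s` and joins the kept vertices of each one.
  same : ∀ (K' : Set V) (τ : Perm V), (∀ x ∈ K', s.lab x ∈ K) → (∀ e ∈ F, e.1 ∈ K' ∧ e.2 ∈ K') →
    (∀ x, s.lab (τ x) = s.lab x) → (∀ x ∈ K', ∀ y ∈ K', s.lab x = s.lab y → τ.SameCycle x y) →
    ∀ x ∈ K', ∀ y ∈ K', labE x = labE y → (σ * τ).SameCycle x y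

variable {I : Inst V} {m : ℕ} {labE : V → V} {A : Finset V} {s : Moat V} {y : ℝ}
  {K : Finset V} {F : List (V × V)} {σ : Perm V}

/-- The start of pruning: the components dropped here are inactive and have no residual penalty
left. -/
theorem Good.tail (h : s.Good I) (hm : s.act.card = m) :
    Tail I m s.lab s.act s 0 s.act [] 1 where
  lab_K := h.lab_act
  A_sub := subset_rfl
  labE_mem _ := id
  labE_congr _ _ := id
  ends := by simp
  card_eq := by simp [hm]
  two_le_deg c h1 h2 := absurd h1 h2
  bound := by
    rw [sum_eq_zero fun c hc => ?_]
    · simp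
    · rw [mem_dropped] at hc
      exact h.p_eq_zero c hc.1 hc.2
  tour := by simp [I.w_self]
  labE_apply _ := rfl
  same K' τ _ _ _ h4 x hx y hy hxy := by simpa using h4 x hx y hy hxy

/-- Undoing a deactivation enlarges the active set, so fewer components are subject to the degree
condition. -/
theorem Tail.of_kill {c : V} (h : Tail I m labE A (s.kill c) y K F σ) :
    Tail I m labE A s y K F σ where
  __ := h
  two_le_deg b hb hb' := h.two_le_deg b hb fun hm => hb' (mem_of_mem_erase hm)

/-- Undoing growth adds `δ` to the slack of a kept edge per active end, and `δ` to the residual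
penalty of each dropped active component. The degrees over `K` sum to `2 * (|K| - m)` and the
inactive members take at least 2 each, so the active ones have at most `2 * (|K ∩ act| - m)`. Adding
2 for each active component outside `K` gives at most `2 * (|act| - m)`. -/
theorem Tail.bound_of_grow {δ : ℝ} (hδ : 0 ≤ δ) (hs : s.Good I)
    (h : Tail I m labE A (s.grow δ) y K F σ) :
    (F.map fun e => I.w s(e.1, e.2) - s.d e.1 - s.d e.2).sum + 2 * ∑ c ∈ s.dropped K, s.p c ≤
      2 * (y + δ * (s.act.card - m)) := by
  have h1 := h.bound
  have e1 : (F.map fun e => I.w s(e.1, e.2) - s.d e.1 - s.d e.2).sum =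
      (F.map fun e => I.w s(e.1, e.2) - (s.grow δ).d e.1 - (s.grow δ).d e.2).sum +
        δ * (∑ c ∈ s.act, s.deg F c : ℕ) := by
    rw [sum_deg]
    clear h1 h
    induction F with
    | nil => simp
    | cons e F ih =>
      simp only [List.map_cons, List.sum_cons, ih, grow]
      push_cast
      split_ifs <;> ring
  have e2 : ∑ c ∈ s.dropped K, s.p c =
      ∑ c ∈ (s.grow δ).dropped K, (s.grow δ).p c + δ * (s.act \ K).card := by
    have e : ∀ c, s.p c = (s.grow δ).p c + if c ∈ s.act then δ else 0 := by
      intro c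
      simp only [grow]
      split_ifs <;> ring
    have e' : s.dropped K ∩ s.act = s.act \ K := by
      ext c
      simp only [mem_inter, mem_dropped, mem_sdiff]
      exact ⟨fun h => ⟨h.2, h.1.2⟩, fun h => ⟨⟨hs.lab_act c h.1, h.2⟩, h.1⟩⟩
    simp only [e, sum_add_distrib, sum_ite_mem, e', sum_const, nsmul_eq_mul]
    have e'' : (s.grow δ).dropped K = s.dropped K := rfl
    rw [e'']
    ring
  have h2 : ∑ c ∈ K, s.deg F c = 2 * F.length := by
    rw [sum_deg]
    have := h.ends
    clear h h1 e1 e2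
    induction F with
    | nil => simp
    | cons e F ih =>
      have h0 := this e (by simp)
      simp only [grow] at h0
      rw [List.map_cons, List.sum_cons, ih fun e he => this e (by simp [he])]
      simp [h0.1, h0.2]
      ring
  have h3 : 2 * (K \ s.act).card ≤ ∑ c ∈ K \ s.act, s.deg F c := by
    rw [mul_comm, ← smul_eq_mul]
    refine card_nsmul_le_sum _ _ _ fun c hc => ?_
    rw [mem_sdiff] at hc
    exact h.two_le_deg c hc.1 hc.2
  have h4 : ∑ c ∈ s.act, s.deg F c = ∑ c ∈ K ∩ s.act, s.deg F c := by
    refine (sum_subset inter_subset_right fun c hc hc' => ?_).symm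
    have hcK : c ∉ K := fun hk => hc' (mem_inter.2 ⟨hk, hc⟩)
    refine List.sum_eq_zero ?_
    simp only [List.mem_map]
    rintro _ ⟨e, he, rfl⟩
    have h5 : s.lab e.1 ∈ K ∧ s.lab e.2 ∈ K := h.ends e he
    have h6 : s.lab e.1 ≠ c := fun e' => hcK (e' ▸ h5.1)
    have h7 : s.lab e.2 ≠ c := fun e' => hcK (e' ▸ h5.2)
    simp [h6, h7]
  have h5 := sum_inter_add_sum_sdiff K s.act (fun c => s.deg F c)
  have h6 := card_inter_add_card_sdiff K s.act
  have h7 := card_inter_add_card_sdiff s.act K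
  have h8 := h.card_eq
  rw [inter_comm] at h7
  have h9 : ∑ c ∈ s.act, s.deg F c + 2 * (s.act \ K).card + 2 * m ≤ 2 * s.act.card := by omega
  have h10 : ((∑ c ∈ s.act, s.deg F c : ℕ) : ℝ) + 2 * (s.act \ K).card + 2 * m ≤
      2 * s.act.card := by exact_mod_cast h9
  have h11 := mul_le_mul_of_nonneg_left h10 hδ
  rw [e1, e2]
  nlinarith

theorem Tail.of_grow {δ : ℝ} (hδ : 0 ≤ δ) (hs : s.Good I)
    (h : Tail I m labE A (s.grow δ) y K F σ) :
    Tail I m labE A s (y + δ * (s.act.card - m)) K F σ where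
  __ := h
  bound := h.bound_of_grow hδ hs

/-- The vertices that are joined by the kept edges. -/
def Touched (F : List (V × V)) (x : V) : Prop := ∃ e ∈ F, x = e.1 ∨ x = e.2

/-! ### Undoing a merge -/

section Merge

variable {u v : V}

theorem merge_lab_eq_iff {x c : V} (h1 : c ≠ s.lab u) (h2 : c ≠ s.lab v) :
    (s.merge u v).lab x = c ↔ s.lab x = c := by
  simp only [merge]
  split_ifs with h
  · rw [h]
    exact ⟨fun e => absurd e.symm h1, fun e => absurd e.symm h2⟩
  · rfl

theorem merge_lab_congr {x x' : V} (h : s.lab x = s.lab x') :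
    (s.merge u v).lab x = (s.merge u v).lab x' := by
  simp [merge, h]

theorem lab_eq_of_merge_lab_eq {x x' : V} (h : (s.merge u v).lab x = (s.merge u v).lab x') :
    s.lab x = s.lab x' ∨ (s.lab x = s.lab u ∧ s.lab x' = s.lab v) ∨
      (s.lab x = s.lab v ∧ s.lab x' = s.lab u) := by
  simp only [merge] at h
  split_ifs at h <;> simp_all

/-- The label of `v` disappears in the merge, whereas `K` consists of labels that exist afterwards.
-/
theorem merge_K (hs : s.Good I) (huv : s.lab u ≠ s.lab v)
    (h : Tail I m labE A (s.merge u v) y K F σ) : s.lab v ∉ K := fun hk =>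
  ((merge_lab_eq_self hs huv).1 (h.lab_K _ hk)).2 rfl

/-- The edge of a merge is dropped if the merged component is dropped, or if the component of `v`
is inactive and untouched. -/
theorem Tail.of_merge_drop (hs : s.Good I) (huv : s.lab u ≠ s.lab v) (hu : s.lab u ∈ s.act)
    (h : Tail I m labE A (s.merge u v) y K F σ)
    (hK : s.lab u ∉ K ∨ s.lab v ∉ s.act ∧ ∀ x, s.lab x = s.lab v → ¬ Touched F x) :
    Tail I m labE A s y K F σ := by
  have hv := merge_K hs huv h
  have hlab : ∀ x, s.lab x ∈ K → (s.merge u v).lab x ∈ K := by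
    intro x hx
    have : s.lab x ≠ s.lab v := fun e => hv (e ▸ hx)
    simpa [merge, this] using hx
  have hends : ∀ x, Touched F x → (s.merge u v).lab x ∈ K → s.lab x ∈ K := by
    intro x hx hxK
    simp only [merge] at hxK
    split_ifs at hxK with hxv
    · rcases hK with hK | hK
      · exact absurd hxK hK
      · exact absurd hx (hK.2 x hxv)
    · exact hxK
  exact {
    lab_K := fun c hc => ((merge_lab_eq_self hs huv).1 (h.lab_K c hc)).1
    A_sub := h.A_sub
    labE_mem := fun x hx => h.labE_mem x (hlab x hx)
    labE_congr := fun x x' hx => h.labE_congr x x' (merge_lab_congr hx)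
    ends := fun e he => ⟨hends _ ⟨e, he, .inl rfl⟩ (h.ends e he).1,
      hends _ ⟨e, he, .inr rfl⟩ (h.ends e he).2⟩
    card_eq := h.card_eq
    two_le_deg := by
      intro c hc hc'
      have h1 : c ≠ s.lab u := fun e => hc' (e ▸ hu)
      have h2 : c ≠ s.lab v := fun e => hv (e ▸ hc)
      rw [← deg_congr (fun x => merge_lab_eq_iff h1 h2)]
      exact h.two_le_deg c hc fun hm => hc' (mem_of_mem_erase hm)
    bound := by
      refine le_trans ?_ h.bound
      have e : s.dropped K =
          insert (s.lab v) ((s.merge u v).dropped K) := by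
        ext c
        simp only [mem_dropped, mem_insert, merge_lab_eq_self hs huv]
        by_cases hc : c = s.lab v
        · subst hc; simp [hs.idem, hv]
        · simp [hc]
      have hnot : s.lab v ∉ (s.merge u v).dropped K := by
        simp [mem_dropped, merge_lab_eq_self hs huv]
      rw [e, sum_insert hnot]
      -- If the merged component is kept, the part newly dropped is inactive and has no residual
      -- penalty. If it is dropped, its residual penalty is split between its two parts.
      by_cases hm : s.lab u ∈ K
      · have h0 : s.p (s.lab v) = 0 := by
          rcases hK with hK | hK
          · exact absurd hm hK
          · exact hs.p_eq_zero _ (hs.idem v) hK.1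
        have e1 : ∑ c ∈ (s.merge u v).dropped K, s.p c =
            ∑ c ∈ (s.merge u v).dropped K, (s.merge u v).p c := by
          refine sum_congr rfl fun c hc => ?_
          have : c ≠ s.lab u := fun e => (mem_dropped.1 hc).2 (e ▸ hm)
          simp [merge, this]
        rw [h0, e1, zero_add]
        exact le_rfl
      · have hu' : s.lab u ∈ (s.merge u v).dropped K := by
          simp only [mem_dropped, merge_lab_eq_self hs huv]
          exact ⟨⟨hs.idem u, huv⟩, hm⟩
        rw [← add_sum_erase _ _ hu', ← add_sum_erase _ _ hu']
        have e1 : ∑ c ∈ ((s.merge u v).dropped K).erase (s.lab u),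
            s.p c = ∑ c ∈ ((s.merge u v).dropped K).erase (s.lab u),
            (s.merge u v).p c := by
          refine sum_congr rfl fun c hc => ?_
          simp [merge, (mem_erase.1 hc).1]
        rw [e1]
        simp only [merge, Function.update_self]
        linarith
    tour := h.tour
    labE_apply := h.labE_apply
    same := by
      intro K' τ h1 h2 h3 h4
      refine h.same K' τ (fun x hx => hlab x (h1 x hx)) h2
        (fun x => merge_lab_congr (h3 x)) fun x hx z hz hxz => ?_
      -- No vertex of `K'` lies in the component of `v`, so the merge identifies no further pairs
      -- within `K'`.
      have hne : ∀ x ∈ K', s.lab x ≠ s.lab v := fun x hx e => hv (e ▸ h1 x hx)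
      rcases lab_eq_of_merge_lab_eq hxz with e | e | e
      · exact h4 x hx z hz e
      · exact absurd e.2 (hne z hz)
      · exact absurd e.1 (hne x hx) }

/-- The edge of a merge is kept if the merged component is kept, and the component of `v` is active
or touched. -/
theorem Tail.of_merge_keep (hs : s.Good I) (huv : s.lab u ≠ s.lab v) (hu : s.lab u ∈ s.act)
    (hw : I.w s(u, v) = s.d u + s.d v)
    (h : Tail I m labE A (s.merge u v) y K F σ) (huK : s.lab u ∈ K)
    (hK : s.lab v ∈ s.act ∨ ∃ x, s.lab x = s.lab v ∧ Touched F x) :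
    Tail I m labE A s y (insert (s.lab v) K) ((u, v) :: F) (σ * swap u v) := by
  have hv := merge_K hs huv h
  have hlab : ∀ x, s.lab x ∈ insert (s.lab v) K ↔ (s.merge u v).lab x ∈ K := by
    intro x
    simp only [merge, mem_insert]
    split_ifs with hx <;> simp [hx, huK]
  have hE : labE u = labE v := h.labE_congr u v (by simp [merge])
  exact {
    lab_K := by
      intro c hc
      rcases mem_insert.1 hc with rfl | hc
      · exact hs.idem v
      · exact ((merge_lab_eq_self hs huv).1 (h.lab_K c hc)).1
    A_sub := h.A_sub.trans (subset_insert _ _)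
    labE_mem := fun x hx => h.labE_mem x ((hlab x).1 hx)
    labE_congr := fun x x' hx => h.labE_congr x x' (merge_lab_congr hx)
    ends := by
      intro e he
      rcases List.mem_cons.1 he with rfl | he
      · exact ⟨mem_insert_of_mem huK, mem_insert_self _ _⟩
      · exact ⟨(hlab _).2 (h.ends e he).1, (hlab _).2 (h.ends e he).2⟩
    card_eq := by
      rw [card_insert_of_notMem hv, ← h.card_eq, List.length_cons]
      ring
    two_le_deg := by
      intro c hc hc'
      have h1 : c ≠ s.lab u := fun e => hc' (e ▸ hu)
      rw [deg_cons]
      by_cases h2 : c = s.lab v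
      · subst h2
        rcases hK with hK | ⟨x, hx, e, he, hxe⟩
        · exact absurd hK hc'
        -- One end comes from an edge kept before, the second from `uv` itself.
        · have := one_le_deg (s := s) (c := s.lab v) he
            (by rcases hxe with rfl | rfl <;> simp [hx])
          simp only [if_true]
          omega
      · rw [← deg_congr (fun x => merge_lab_eq_iff h1 h2) F]
        have := h.two_le_deg c ((mem_insert.1 hc).resolve_left h2)
          fun hm => hc' (mem_of_mem_erase hm)
        omega
    bound := by
      -- The set of dropped components stays the same, and the tight edge `uv` has slack zero.
      refine le_trans (le_of_eq ?_) h.bound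
      have e : s.dropped (insert (s.lab v) K) =
          (s.merge u v).dropped K := by
        ext c
        simp only [mem_dropped, mem_insert, merge_lab_eq_self hs huv]
        tauto
      have e1 : ∑ c ∈ (s.merge u v).dropped K, s.p c =
          ∑ c ∈ (s.merge u v).dropped K, (s.merge u v).p c := by
        refine sum_congr rfl fun c hc => ?_
        have : c ≠ s.lab u := fun e => (mem_dropped.1 hc).2 (e ▸ huK)
        simp [merge, this]
      rw [e, e1, List.map_cons, List.sum_cons, hw]
      simp only [merge]
      ring
    tour := by
      have := sum_mul_swap_le I σ (fun e : u = v => huv (e ▸ rfl))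
      have h1 := h.tour
      rw [List.map_cons, List.sum_cons]
      linarith
    labE_apply := by
      intro x
      rw [Perm.mul_apply, h.labE_apply]
      by_cases h1 : x = u
      · rw [h1, swap_apply_left, hE]
      · by_cases h2 : x = v
        · rw [h2, swap_apply_right, hE]
        · rw [swap_apply_of_ne_of_ne h1 h2]
    same := by
      intro K' τ h1 h2 h3 h4
      have h0 := h2 (u, v) (by simp)
      have hτ : ∀ x (i : ℕ), s.lab ((τ ^ i) x) = s.lab x := by
        intro x i
        induction i with
        | zero => rfl
        | succ i ih => rw [pow_succ', Perm.mul_apply, h3, ih]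
      -- Since `τ` preserves the components of `s`, the vertices `u` and `v` lie in different
      -- cycles. By associativity the transposition passes from `σ` to `τ`, where it joins these
      -- cycles as required for the merged component.
      have hnot : ¬ τ.SameCycle u v := by
        intro hc
        obtain ⟨i, hi⟩ := hc.exists_nat_pow_eq
        exact huv (by rw [← hi, hτ])
      have hsame := sameCycle_swap_mul hnot
      rw [mul_assoc]
      refine h.same K' (swap u v * τ) (fun x hx => (hlab x).1 (h1 x hx))
        (fun e he => h2 e (by simp [he])) (fun x => ?_) fun x hx z hz hxz => ?_
      · rw [Perm.mul_apply]
        have e2 := merge_lab_congr (u := u) (v := v) (h3 x)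
        by_cases g1 : τ x = u
        · rw [← e2, g1, swap_apply_left]
          simp [merge]
        · by_cases g2 : τ x = v
          · rw [← e2, g2, swap_apply_right]
            simp [merge]
          · rw [swap_apply_of_ne_of_ne g1 g2, e2]
      · rcases lab_eq_of_merge_lab_eq hxz with e | e | e
        · exact SameCycle.swap_mul hnot (h4 x hx z hz e)
        · exact ((SameCycle.swap_mul hnot (h4 x hx u h0.1 e.1)).trans hsame).trans
            (SameCycle.swap_mul hnot (h4 v h0.2 z hz e.2.symm))
        · exact ((SameCycle.swap_mul hnot (h4 x hx v h0.2 e.1)).trans hsame.symm).trans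
            (SameCycle.swap_mul hnot (h4 u h0.1 z hz e.2.symm)) }

end Merge

/-! ### Runs of moat growing -/

/-- `Hist I m l s y`: moat growing leads to the state `s` with lower bound `y`, and `l` lists the
merges, the last one first, each by its edge and the state before the merge. -/
inductive Hist (I : Inst V) (m : ℕ) : List (V × V × Moat V) → Moat V → ℝ → Prop
  | init : Hist I m [] (Moat.init I) 0
  | grow {l s y δ} : Hist I m l s y → s.Good I → 0 ≤ δ →
      Hist I m l (s.grow δ) (y + δ * (s.act.card - m))
  | kill {l s y} (c : V) : Hist I m l s y → Hist I m l (s.kill c) y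
  | merge {l s y u v} : Hist I m l s y → s.Good I → s.lab u ≠ s.lab v → s.lab u ∈ s.act →
      I.w s(u, v) = s.d u + s.d v → Hist I m ((u, v, s) :: l) (s.merge u v) y

/-- Deactivation needs no argument because `lower` does not depend on the active set. -/
theorem Hist.le_lower {l : List (V × V × Moat V)} (h : Hist I m l s y) (T : PathFamily V m) :
    y ≤ s.lower I T := by
  induction h with
  | init => exact lower_init I T
  | grow _ hs hδ ih => exact (add_le_add_left ih _).trans (lower_grow hs hδ T)
  | kill c _ ih => exact ih
  | merge _ hs huv _ _ ih => exact ih.trans (lower_merge hs huv T)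

/-- Undoing events until there is a merge. -/
theorem Hist.rewind {u v : V} {s' : Moat V} {l l' : List (V × V × Moat V)} (h : Hist I m l' s y)
    (hl : l' = (u, v, s') :: l) {yE : ℝ} (ht : Tail I m labE A s (yE - y) K F σ) :
    ∃ y', Hist I m l s' y' ∧ s'.Good I ∧ s'.lab u ≠ s'.lab v ∧ s'.lab u ∈ s'.act ∧
      I.w s(u, v) = s'.d u + s'.d v ∧ Tail I m labE A (s'.merge u v) (yE - y') K F σ := by
  -- Growth and deactivation leave `K`, `F` and `σ` unchanged, so undoing them is a matter of proof
  -- only; the program has to undo nothing but the merges.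
  induction h with
  | init => cases hl
  | grow _ hs hδ ih =>
    refine ih hl ?_
    have := ht.of_grow hδ hs
    rwa [sub_add_eq_sub_sub, sub_add_cancel] at this
  | kill c _ ih => exact ih hl ht.of_kill
  | merge h hs huv hu hw ih =>
    cases hl
    exact ⟨_, h, hs, huv, hu, hw, ht⟩

/-- Undoing all events if there is no merge. -/
theorem Hist.rewind_nil {l : List (V × V × Moat V)} (h : Hist I m l s y) (hl : l = []) {yE : ℝ}
    (ht : Tail I m labE A s (yE - y) K F σ) : Tail I m labE A (Moat.init I) yE K F σ := by
  induction h with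
  | init => simpa using ht
  | grow _ hs hδ ih =>
    refine ih hl ?_
    have := ht.of_grow hδ hs
    rwa [sub_add_eq_sub_sub, sub_add_cancel] at this
  | kill c _ ih => exact ih hl ht.of_kill
  | merge => cases hl

end Moat

/-! ### Paths from the cycles of a permutation -/

/-- The right-hand sum also charges the step out of the last entry, a nonnegative surplus: for a
cycle this is the edge deleted to open the tour. -/
theorem exists_pathIn {V : Type*} (σ : V → V) (l : List V) (hl : l ≠ []) (hn : l.Nodup)
    (hc : l.IsChain fun a b => b = σ a) :
    ∃ P : PathIn V, P.verts = l ∧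
      ∀ I : Inst V, I.pathWeight P ≤ (l.map fun a => I.w s(a, σ a)).sum := by
  induction l with
  | nil => exact absurd rfl hl
  | cons a l ih =>
    cases l with
    | nil =>
      refine ⟨⟨a, a, .nil, by simp⟩, by simp [PathIn.verts], fun I => ?_⟩
      simpa [Inst.pathWeight] using I.w_nonneg _
    | cons b l =>
      rw [List.nodup_cons] at hn
      rw [List.isChain_cons_cons] at hc
      obtain ⟨⟨x, z, q, hq⟩, hv, hw⟩ := ih (by simp) hn.2 hc.2
      have hx : x = b := by
        have : x :: q.support.tail = b :: l := q.cons_tail_support.trans hv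
        exact (List.cons.inj this).1
      subst hx
      have hab : a ≠ x := fun e => hn.1 (by simp [e])
      change q.support = _ at hv
      refine ⟨⟨a, z, .cons (SimpleGraph.top_adj a x |>.2 hab) q, ?_⟩, ?_, fun I => ?_⟩
      · rw [SimpleGraph.Walk.cons_isPath_iff]
        exact ⟨hq, by rw [hv]; exact hn.1⟩
      · simp [PathIn.verts, hv]
      · have h1 := hw I
        simp only [Inst.pathWeight, SimpleGraph.Walk.edges_cons, List.map_cons,
          List.sum_cons] at h1 ⊢
        have e : I.w s(a, x) = I.w s(a, σ a) := congrArg (fun t => I.w s(a, t)) hc.1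
        linarith

open Function in
/-- The cycle of `c`, as a list that starts with `c`. -/
noncomputable def cycleList {V : Type*} (σ : V → V) (c : V) : List V :=
  (List.range (minimalPeriod σ c)).map fun i => σ^[i] c

open Function in
theorem minimalPeriod_perm_pos {V : Type*} [Finite V] (σ : Equiv.Perm V) (c : V) :
    0 < minimalPeriod σ c :=
  minimalPeriod_pos_of_mem_periodicPts (σ.injective.mem_periodicPts c)

open Function in
theorem nodup_cycleList {V : Type*} (σ : V → V) (c : V) : (cycleList σ c).Nodup := by
  refine List.Nodup.map_on (fun i hi j hj hij => ?_) List.nodup_range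
  rw [List.mem_range] at hi hj
  exact (iterate_eq_iterate_iff_of_lt_minimalPeriod hi hj).1 hij

open Function in
theorem mem_cycleList {V : Type*} [Finite V] {σ : Equiv.Perm V} {c x : V} :
    x ∈ cycleList σ c ↔ σ.SameCycle c x := by
  simp only [cycleList, List.mem_map, List.mem_range]
  constructor
  · rintro ⟨i, -, rfl⟩
    exact ⟨i, by rw [zpow_natCast, ← Equiv.Perm.iterate_eq_pow]⟩
  · intro h
    obtain ⟨i, hi⟩ := h.exists_nat_pow_eq
    refine ⟨i % minimalPeriod σ c, Nat.mod_lt _ (minimalPeriod_perm_pos σ c), ?_⟩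
    rw [iterate_mod_minimalPeriod_eq, Equiv.Perm.iterate_eq_pow, hi]

open Function in
theorem isChain_cycleList {V : Type*} (σ : V → V) (c : V) :
    (cycleList σ c).IsChain fun a b => b = σ a := by
  rw [cycleList, List.isChain_map]
  refine List.isChain_iff_getElem.2 fun i hi => ?_
  simp [iterate_succ_apply']

namespace Moat

open Equiv

variable {V : Type*} [DecidableEq V] [Fintype V] {I : Inst V} {m : ℕ} {labE : V → V}
  {A : Finset V} {y : ℝ} {K : Finset V} {F : List (V × V)} {σ : Perm V}

/-- The cycles of the final permutation are the paths of a solution. -/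
theorem Tail.exists_family (h : Tail I m labE A (Moat.init I) y K F σ)
    (hA : ∀ c ∈ A, labE c = c) (hm : A.card = m) (c : Fin m → V) (hc : Function.Injective c)
    (hcA : ∀ j, c j ∈ A) :
    ∃ T : PathFamily V m, (∀ j, (T.path j).verts = cycleList σ (c j)) ∧
      I.weight T + 4 * I.uncovered T ≤ 4 * y := by
  have hne : ∀ j, cycleList σ (c j) ≠ [] := fun j e => by
    have := (minimalPeriod_perm_pos σ (c j)).ne'
    simp [cycleList] at e
    exact this e
  choose P hP hPw using fun j => exists_pathIn σ (cycleList σ (c j)) (hne j) (nodup_cycleList _ _)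
    (isChain_cycleList _ _)
  -- The final label is constant along cycles, so the cycles through different final labels are
  -- disjoint.
  have hlab : ∀ x z, σ.SameCycle x z → labE x = labE z := by
    intro x z hxz
    obtain ⟨i, rfl⟩ := hxz.exists_nat_pow_eq
    clear hxz
    induction i with
    | zero => rfl
    | succ i ih => rw [pow_succ', Perm.mul_apply, h.labE_apply, ← ih]
  have hdisj : ∀ i j, i ≠ j → (cycleList σ (c i)).Disjoint (cycleList σ (c j)) := by
    intro i j hij x hx hx'
    rw [mem_cycleList] at hx hx'
    have := (hlab _ _ hx).trans (hlab _ _ hx').symm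
    rw [hA _ (hcA i), hA _ (hcA j)] at this
    exact hij (hc this)
  let T : PathFamily V m := ⟨P, fun i j hij => by rw [hP, hP]; exact hdisj i j hij⟩
  refine ⟨T, hP, ?_⟩
  have h1 : I.weight T ≤ ∑ x, I.w s(x, σ x) := by
    have e : ∀ j, ((cycleList σ (c j)).map fun a => I.w s(a, σ a)).sum =
        ∑ a ∈ (cycleList σ (c j)).toFinset, I.w s(a, σ a) := fun j =>
      (List.sum_toFinset _ (nodup_cycleList _ _)).symm
    calc I.weight T ≤ ∑ j, ∑ a ∈ (cycleList σ (c j)).toFinset, I.w s(a, σ a) :=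
          sum_le_sum fun j _ => (hPw j I).trans (e j).le
      _ = ∑ a ∈ univ.biUnion fun j => (cycleList σ (c j)).toFinset, I.w s(a, σ a) := by
          rw [sum_biUnion]
          intro i _ j _ hij
          exact List.disjoint_toFinset_iff_disjoint.2 (hdisj i j hij)
      _ ≤ _ := sum_le_sum_of_subset_of_nonneg (subset_univ _) fun x _ _ => I.w_nonneg _
  have hsurj : ∀ b ∈ A, ∃ j, c j = b := by
    have e : univ.image c = A := by
      refine eq_of_subset_of_card_le (fun b hb => ?_) ?_
      · obtain ⟨j, -, rfl⟩ := mem_image.1 hb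
        exact hcA j
      · rw [card_image_of_injective _ hc, card_univ, Fintype.card_fin, hm]
    intro b hb
    rw [← e] at hb
    obtain ⟨j, -, hj⟩ := mem_image.1 hb
    exact ⟨j, hj⟩
  have hcov : ∀ x ∈ K, x ∈ T.spanned := by
    intro x hx
    obtain ⟨j, hj⟩ := hsurj (labE x) (h.labE_mem x hx)
    refine ⟨j, ?_⟩
    change x ∈ (P j).verts
    rw [hP, mem_cycleList, hj]
    -- In the initial state components are single vertices, so the identity qualifies as `τ`. A kept
    -- vertex and its final label both lie in `K`, hence in one cycle.
    have := h.same K 1 (fun x hx => hx) (fun e he => h.ends e he) (fun _ => rfl)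
      (fun x _ z _ e => by
        change x = z at e
        rw [e])
      (labE x) (h.A_sub (h.labE_mem x hx)) x hx (hA _ (h.labE_mem x hx))
    rwa [mul_one] at this
  have h2 : I.uncovered T ≤ ∑ x ∈ (Moat.init I).dropped K, (Moat.init I).p x := by
    classical
    rw [Inst.uncovered]
    refine sum_le_sum_of_subset_of_nonneg (fun x hx => ?_) fun x _ _ => I.penalty_nonneg x
    rw [mem_filter] at hx
    exact mem_dropped.2 ⟨rfl, fun hk => hx.2 (hcov x hk)⟩
  -- The factor 4 is the 2 of the degree count times the 2 of doubling the edges.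
  have h3 := h.bound
  have e : (F.map fun e => I.w s(e.1, e.2) - (Moat.init I).d e.1 - (Moat.init I).d e.2) =
      F.map fun e => I.w s(e.1, e.2) := List.map_congr_left fun e _ => by simp [Moat.init]
  rw [e] at h3
  have h4 := h.tour
  linarith

end Moat

/-! ## Verification of programs -/

/-- Started with memory `s`, the program `c` halts, and the running time and the final memory
satisfy `Q`. -/
def wp (c : Cmd) (Q : ℕ → Mem → Prop) (s : Mem) : Prop := ∃ t s', Exec c s t s' ∧ Q t s'

theorem wp_mono {c : Cmd} {Q Q' : ℕ → Mem → Prop} {s : Mem} (h : wp c Q s)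
    (hQ : ∀ t s', Q t s' → Q' t s') : wp c Q' s := by
  obtain ⟨t, s', he, hq⟩ := h
  exact ⟨t, s', he, hQ t s' hq⟩

theorem wp_skip {Q : ℕ → Mem → Prop} {s : Mem} : wp .skip Q s ↔ Q 1 s :=
  ⟨fun ⟨_, _, he, hq⟩ => by cases he; exact hq, fun h => ⟨_, _, .skip s, h⟩⟩

theorem wp_setN {x : ℕ} {e : NExpr} {Q : ℕ → Mem → Prop} {s : Mem} :
    wp (.setN x e) Q s ↔ Q (e.cost + 1) (s.setN x (e.eval s)) :=
  ⟨fun ⟨_, _, he, hq⟩ => by cases he; exact hq, fun h => ⟨_, _, .setN s x e, h⟩⟩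

theorem wp_setR {x : ℕ} {e : RExpr} {Q : ℕ → Mem → Prop} {s : Mem} :
    wp (.setR x e) Q s ↔ Q (e.cost + 1) (s.setR x (e.eval s)) :=
  ⟨fun ⟨_, _, he, hq⟩ => by cases he; exact hq, fun h => ⟨_, _, .setR s x e, h⟩⟩

theorem wp_putN {a : ℕ} {i e : NExpr} {Q : ℕ → Mem → Prop} {s : Mem} :
    wp (.putN a i e) Q s ↔ Q (i.cost + e.cost + 1) (s.putN a (i.eval s) (e.eval s)) :=
  ⟨fun ⟨_, _, he, hq⟩ => by cases he; exact hq, fun h => ⟨_, _, .putN s a i e, h⟩⟩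

theorem wp_putR {a : ℕ} {i : NExpr} {e : RExpr} {Q : ℕ → Mem → Prop} {s : Mem} :
    wp (.putR a i e) Q s ↔ Q (i.cost + e.cost + 1) (s.putR a (i.eval s) (e.eval s)) :=
  ⟨fun ⟨_, _, he, hq⟩ => by cases he; exact hq, fun h => ⟨_, _, .putR s a i e, h⟩⟩

theorem wp_seq {c₁ c₂ : Cmd} {Q : ℕ → Mem → Prop} {s : Mem} :
    wp (.seq c₁ c₂) Q s ↔ wp c₁ (fun t₁ s₁ => wp c₂ (fun t₂ s₂ => Q (t₁ + t₂) s₂) s₁) s := by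
  constructor
  · rintro ⟨_, _, he, hq⟩
    cases he with
    | seq h₁ h₂ => exact ⟨_, _, h₁, _, _, h₂, hq⟩
  · rintro ⟨_, _, h₁, _, _, h₂, hq⟩
    exact ⟨_, _, .seq h₁ h₂, hq⟩

theorem wp_ite {b : BExpr} {c₁ c₂ : Cmd} {Q : ℕ → Mem → Prop} {s : Mem} :
    wp (.ite b c₁ c₂) Q s ↔
      (b.Holds s → wp c₁ (fun t => Q (b.cost + 1 + t)) s) ∧
        (¬ b.Holds s → wp c₂ (fun t => Q (b.cost + 1 + t)) s) := by
  constructor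
  · rintro ⟨_, _, he, hq⟩
    cases he with
    | iteTrue hb h => exact ⟨fun _ => ⟨_, _, h, hq⟩, fun hn => absurd hb hn⟩
    | iteFalse hb h => exact ⟨fun hn => absurd hn hb, fun _ => ⟨_, _, h, hq⟩⟩
  · rintro ⟨h₁, h₂⟩
    by_cases hb : b.Holds s
    · obtain ⟨t, s', he, hq⟩ := h₁ hb
      exact ⟨_, _, .iteTrue hb he, hq⟩
    · obtain ⟨t, s', he, hq⟩ := h₂ hb
      exact ⟨_, _, .iteFalse hb he, hq⟩

/-- A loop with a counter `f` that bounds the number of the remaining iterations. -/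
theorem wp_while {b : BExpr} {c : Cmd} {Inv : ℕ → Mem → Prop} {T f : ℕ} {s : Mem}
    (h : Inv f s)
    (step : ∀ f s, Inv f s → b.Holds s →
      wp c (fun t s' => t ≤ T ∧ ∃ f' < f, Inv f' s') s) :
    wp (.while b c) (fun t s' => t ≤ (f + 1) * (T + b.cost + 1) ∧ ¬ b.Holds s' ∧
      ∃ f', Inv f' s') s := by
  induction f using Nat.strong_induction_on generalizing s with
  | _ f ih =>
    by_cases hb : b.Holds s
    · obtain ⟨t, s₁, he, ht, f', hf', hi⟩ := step f s h hb
      obtain ⟨t₂, s₂, he₂, ht₂, hn, hi₂⟩ := ih f' hf' hi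
      refine ⟨_, _, .whileTrue hb he he₂, ?_, hn, hi₂⟩
      have : (f' + 1) * (T + b.cost + 1) ≤ f * (T + b.cost + 1) :=
        Nat.mul_le_mul_right _ hf'
      rw [add_mul f]
      omega
    · refine ⟨_, _, .whileFalse hb, ?_, hb, f, h⟩
      nlinarith

/-- `for i := 0 to n - 1 do c`, where `n` is the value of register `0`. -/
def Cmd.loop (i : ℕ) (c : Cmd) : Cmd :=
  .seq (.setN i (.const 0))
    (.while (.natLe (.add (.var i) (.const 1)) (.var 0))
      (.seq c (.setN i (.add (.var i) (.const 1)))))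

/-- Per iteration the overhead is 6 steps for the test and 4 for the increment; the final 2 steps
initialize the counter. -/
theorem wp_loop {i n T : ℕ} {c : Cmd} {Inv : ℕ → Mem → Prop} {s : Mem}
    (h : Inv 0 (s.setN i 0))
    (hn : ∀ k s, Inv k s → s.ivar 0 = n ∧ s.ivar i = k)
    (step : ∀ k < n, ∀ s, Inv k s → wp c (fun t s' => t ≤ T ∧ s'.ivar i = k ∧
      Inv (k + 1) (s'.setN i (k + 1))) s) :
    wp (.loop i c) (fun t s' => t ≤ (n + 1) * (T + 10) + 2 ∧ Inv n s') s := by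
  rw [Cmd.loop, wp_seq, wp_setN]
  refine wp_mono (wp_while (Inv := fun f s => ∃ k, f + k = n ∧ Inv k s) (T := T + 4) (f := n)
    ⟨0, by simp, h⟩ ?_) ?_
  · rintro f s ⟨k, hk, hi⟩ hb
    obtain ⟨h1, h2⟩ := hn k s hi
    simp only [BExpr.Holds, NExpr.eval, h1, h2] at hb
    rw [wp_seq]
    refine wp_mono (step k hb s hi) ?_
    rintro t s' ⟨ht, hs', hi'⟩
    rw [wp_setN]
    simp only [NExpr.eval, NExpr.cost, hs']
    exact ⟨by omega, f - 1, by omega, k + 1, by omega, hi'⟩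
  · rintro t s' ⟨ht, hb, f', k, hk, hi⟩
    obtain ⟨h1, h2⟩ := hn k s' hi
    simp only [BExpr.Holds, NExpr.eval, h1, h2] at hb
    have : k = n := by omega
    subst this
    refine ⟨?_, hi⟩
    simp only [BExpr.cost, NExpr.cost] at ht ⊢
    have : (k + 1) * (T + 4 + (1 + 1 + 1 + 1 + 1) + 1) = (k + 1) * (T + 10) := by ring
    omega

/-! ## The program -/

namespace Mem

variable (s : Mem) (x a i v : ℕ) (r : ℝ)

theorem setN_ivar : (s.setN x v).ivar = Function.update s.ivar x v := rfl
theorem setN_iarr : (s.setN x v).iarr = s.iarr := rfl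
theorem setN_rvar : (s.setN x v).rvar = s.rvar := rfl
theorem setN_rarr : (s.setN x v).rarr = s.rarr := rfl
theorem setR_ivar : (s.setR x r).ivar = s.ivar := rfl
theorem setR_iarr : (s.setR x r).iarr = s.iarr := rfl
theorem setR_rvar : (s.setR x r).rvar = Function.update s.rvar x r := rfl
theorem setR_rarr : (s.setR x r).rarr = s.rarr := rfl
theorem putN_ivar : (s.putN a i v).ivar = s.ivar := rfl
theorem putN_iarr : (s.putN a i v).iarr =
    Function.update s.iarr a (Function.update (s.iarr a) i v) := rfl
theorem putN_rarr : (s.putN a i v).rarr = s.rarr := rfl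
theorem putR_ivar : (s.putR a i r).ivar = s.ivar := rfl
theorem putR_iarr : (s.putR a i r).iarr = s.iarr := rfl
theorem putR_rvar : (s.putR a i r).rvar = s.rvar := rfl
theorem putR_rarr : (s.putR a i r).rarr =
    Function.update s.rarr a (Function.update (s.rarr a) i r) := rfl

end Mem

variable {n m : ℕ} {I : Inst (Fin n)} {st : Moat (Fin n)} {s : Mem}

/-- The memory `s` represents the state `st` of moat growing: register `0` holds `n`, the natural
arrays `2` and `3` hold the labels and the inactivity flags, and the real arrays `0`, `1` and `2`
hold the weights, the residual penalties and the growth. -/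
structure Rep {n : ℕ} (I : Inst (Fin n)) (st : Moat (Fin n)) (s : Mem) : Prop where
  n_eq : s.ivar 0 = n
  lab : ∀ x : Fin n, s.iarr 2 x = st.lab x
  dead : ∀ x : Fin n, s.iarr 3 x = if x ∈ st.act then 0 else 1
  w : ∀ x y : Fin n, s.rarr 0 (x * n + y) = I.w s(x, y)
  p : ∀ x : Fin n, s.rarr 1 x = st.p x
  d : ∀ x : Fin n, s.rarr 2 x = st.d x

/-! ### Growing -/

/-- All active components grow by the value of the real register `0`. -/
def growCmd : Cmd :=
  .loop 14 (.seq
    (.ite (.natLe (.get 3 (.get 2 (.var 14))) (.const 0))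
      (.putR 2 (.var 14) (.add (.get 2 (.var 14)) (.var 0))) .skip)
    (.ite (.natLe (.get 3 (.var 14)) (.const 0))
      (.putR 1 (.var 14) (.sub (.get 1 (.var 14)) (.var 0))) .skip))

theorem Rep.dead_lab (h : Rep I st s) (x : Fin n) :
    s.iarr 3 (s.iarr 2 x) = if st.lab x ∈ st.act then 0 else 1 := by
  rw [h.lab, h.dead]

theorem wp_growCmd {δ : ℝ} (h : Rep I st s) (hδ : s.rvar 0 = δ) :
    wp growCmd (fun t s' => t ≤ (n + 1) * 40 + 2 ∧ Rep I (st.grow δ) s' ∧ s'.iarr = s.iarr ∧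
      ∀ r, r ≠ 14 → s'.ivar r = s.ivar r) s := by
  -- Only the vertices below `k` have grown. The pass can work in place because the tests read
  -- labels and flags, which growth leaves alone.
  let part : ℕ → Moat (Fin n) := fun k =>
    ⟨st.lab, st.act, fun x => if x.val < k then (st.grow δ).d x else st.d x,
      fun x => if x.val < k then (st.grow δ).p x else st.p x⟩
  refine wp_mono (wp_loop (n := n) (T := 30) (Inv := fun k s' => Rep I (part k) s' ∧
    s'.rvar 0 = δ ∧ s'.ivar 14 = k ∧ s'.iarr = s.iarr ∧ ∀ r, r ≠ 14 → s'.ivar r = s.ivar r)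
    ?_ ?_ ?_) ?_
  · refine ⟨⟨?_, h.lab, h.dead, h.w, ?_, ?_⟩, hδ, by simp [Mem.setN_ivar], rfl, fun r hr => ?_⟩
    · simpa [Mem.setN_ivar] using h.n_eq
    · simpa [part, Mem.setN_rarr] using h.p
    · simpa [part, Mem.setN_rarr] using h.d
    · simp [Mem.setN_ivar, hr]
  · rintro k s' ⟨h1, -, h2, -⟩
    exact ⟨h1.n_eq, h2⟩
  · rintro k hk s' ⟨h1, h2, h3, h4, h5⟩
    have e1 := h1.dead_lab ⟨k, hk⟩
    have e2 := h1.dead ⟨k, hk⟩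
    have e3 := h1.p ⟨k, hk⟩
    have e4 := h1.d ⟨k, hk⟩
    have hp' : ∀ x : Fin n, (part (k + 1)).p x =
        if x.val = k then (st.grow δ).p x else (part k).p x := by
      intro x
      simp only [part]
      split_ifs <;> first | rfl | omega
    have hd' : ∀ x : Fin n, (part (k + 1)).d x =
        if x.val = k then (st.grow δ).d x else (part k).d x := by
      intro x
      simp only [part]
      split_ifs <;> first | rfl | omega
    simp only [part, lt_irrefl, if_false] at e1 e2 e3 e4
    have fin : ∀ s'' : Mem, s''.ivar = s'.ivar → s''.iarr = s'.iarr → s''.rvar = s'.rvar →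
        s''.rarr 0 = s'.rarr 0 →
        s''.rarr 1 = Function.update (s'.rarr 1) k ((st.grow δ).p ⟨k, hk⟩) →
        s''.rarr 2 = Function.update (s'.rarr 2) k ((st.grow δ).d ⟨k, hk⟩) →
        s''.ivar 14 = k ∧ Rep I (part (k + 1)) (s''.setN 14 (k + 1)) ∧
          (s''.setN 14 (k + 1)).rvar 0 = δ ∧ (s''.setN 14 (k + 1)).ivar 14 = k + 1 ∧
          (s''.setN 14 (k + 1)).iarr = s.iarr ∧
          ∀ r, r ≠ 14 → (s''.setN 14 (k + 1)).ivar r = s.ivar r := by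
      intro s'' g1 g2 g3 g4 g5 g6
      refine ⟨by rw [g1, h3], ⟨?_, ?_, ?_, ?_, fun x => ?_, fun x => ?_⟩, ?_, ?_, ?_, ?_⟩
      · simpa [Mem.setN_ivar, g1] using h1.n_eq
      · simpa [Mem.setN_iarr, g2] using h1.lab
      · simpa [Mem.setN_iarr, g2] using h1.dead
      · simpa [Mem.setN_rarr, g4] using h1.w
      · rw [Mem.setN_rarr, g5, Function.update_apply, hp', h1.p]
        split_ifs with e
        · subst e; rfl
        · rfl
      · rw [Mem.setN_rarr, g6, Function.update_apply, hd', h1.d]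
        split_ifs with e
        · subst e; rfl
        · rfl
      · simpa [Mem.setN_rvar, g3] using h2
      · simp [Mem.setN_ivar]
      · rw [Mem.setN_iarr, g2, h4]
      · intro r hr
        simp [Mem.setN_ivar, hr, g1, h5]
    have eff : wp (.seq
        (.ite (.natLe (.get 3 (.get 2 (.var 14))) (.const 0))
          (.putR 2 (.var 14) (.add (.get 2 (.var 14)) (.var 0))) .skip)
        (.ite (.natLe (.get 3 (.var 14)) (.const 0))
          (.putR 1 (.var 14) (.sub (.get 1 (.var 14)) (.var 0))) .skip))
        (fun t s'' => t ≤ 30 ∧ s''.ivar = s'.ivar ∧ s''.iarr = s'.iarr ∧ s''.rvar = s'.rvar ∧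
          s''.rarr 0 = s'.rarr 0 ∧
          s''.rarr 1 = Function.update (s'.rarr 1) k ((st.grow δ).p ⟨k, hk⟩) ∧
          s''.rarr 2 = Function.update (s'.rarr 2) k ((st.grow δ).d ⟨k, hk⟩)) s' := by
      simp only [wp_seq, wp_ite, wp_putR, wp_skip, BExpr.Holds, NExpr.eval, RExpr.eval, BExpr.cost,
        NExpr.cost, RExpr.cost, h3, e1, e2, e3, e4, h2, Mem.putR_iarr, Mem.putR_ivar, Mem.putR_rarr,
        Mem.putR_rvar]
      by_cases a1 : st.lab ⟨k, hk⟩ ∈ st.act <;> by_cases a2 : (⟨k, hk⟩ : Fin n) ∈ st.act <;>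
      simp [a1, a2, Moat.grow, e3, e4]
    refine wp_mono eff ?_
    rintro t s'' ⟨ht, g1, g2, g3, g4, g5, g6⟩
    exact ⟨ht, fin s'' g1 g2 g3 g4 g5 g6⟩
  · rintro t s' ⟨ht, h1, h2, h3, h4, h5⟩
    refine ⟨ht, ⟨h1.n_eq, h1.lab, h1.dead, h1.w, fun x => ?_, fun x => ?_⟩, h4, h5⟩
    · simpa [part] using h1.p x
    · simpa [part] using h1.d x

theorem Rep.congr {s' : Mem} (h : Rep I st s) (h0 : s'.ivar 0 = s.ivar 0)
    (h2 : s'.iarr 2 = s.iarr 2) (h3 : s'.iarr 3 = s.iarr 3) (hr : s'.rarr = s.rarr) :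
    Rep I st s' :=
  ⟨h0.trans h.n_eq, h2 ▸ h.lab, h3 ▸ h.dead, hr ▸ h.w, hr ▸ h.p, hr ▸ h.d⟩

/-! ### The next event -/

namespace Moat

/-- The pair `uv` stands for a possible event: the components of `u` and `v` are merged, or the
component of `u = v` becomes inactive. -/
def Valid (st : Moat (Fin n)) (u v : Fin n) : Prop :=
  st.lab u ∈ st.act ∧ (st.lab u = st.lab v → u = v)

/-- The time until the event `uv`. -/
noncomputable def delay (I : Inst (Fin n)) (st : Moat (Fin n)) (u v : Fin n) : ℝ :=
  if u = v then st.p (st.lab u)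
  else if st.lab v ∈ st.act then (1 / 2 : ℚ) * (I.w s(u, v) - st.d u - st.d v)
  else I.w s(u, v) - st.d u - st.d v

theorem delay_nonneg (h : st.Good I) {u v : Fin n} (huv : st.Valid u v) : 0 ≤ st.delay I u v := by
  rw [delay]
  split_ifs with h1 h2
  · exact h.p_nonneg _ (h.idem u)
  all_goals
    have := h.d_le u v fun e => h1 (huv.2 e)
    push_cast
    linarith

/-- The invariants are maintained until the next event. -/
theorem Good.grow_delay (h : st.Good I) {δ : ℝ}
    (hδ : ∀ u v, st.Valid u v → δ ≤ st.delay I u v) : (st.grow δ).Good I := by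
  refine h.grow (fun c hc => ?_) (fun u v huv hu hv => ?_) (fun u v huv hu hv => ?_)
  · have := hδ c c ⟨by rwa [h.lab_act c hc], fun _ => rfl⟩
    simpa [delay, h.lab_act c hc] using this
  · have := hδ u v ⟨hu, fun e => absurd e huv⟩
    have hne : u ≠ v := fun e => huv (e ▸ rfl)
    simpa [delay, hne, hv] using this
  · have := hδ u v ⟨hu, fun e => absurd e huv⟩
    have hne : u ≠ v := fun e => huv (e ▸ rfl)
    simp only [delay, hne, hv, if_true, if_false] at this
    push_cast at this
    linarith

end Moat

/-- The test whether the values of two expressions are equal. -/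
def BExpr.natEq (e₁ e₂ : NExpr) : BExpr := .and (.natLe e₁ e₂) (.natLe e₂ e₁)

theorem BExpr.natEq_holds {e₁ e₂ : NExpr} : (BExpr.natEq e₁ e₂).Holds s ↔ e₁.eval s = e₂.eval s :=
  le_antisymm_iff.symm

theorem BExpr.natEq_cost {e₁ e₂ : NExpr} :
    (BExpr.natEq e₁ e₂).cost = e₁.cost + e₂.cost + 1 + (e₂.cost + e₁.cost + 1) + 1 := rfl

/-- Consider the event given by the registers `5` and `6`, the best event found so far being given
by the registers `7` and `8`, its time by the real register `0`. -/
def scanBody : Cmd :=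
  .ite (.and (.natLe (.get 3 (.get 2 (.var 5))) (.const 0))
      (.not (.and (.natEq (.get 2 (.var 5)) (.get 2 (.var 6)))
        (.not (.natEq (.var 5) (.var 6))))))
    (.seq
      (.ite (.natEq (.var 5) (.var 6))
        (.setR 1 (.get 1 (.get 2 (.var 5))))
        (.ite (.natLe (.get 3 (.get 2 (.var 6))) (.const 0))
          (.setR 1 (.smul (1 / 2) (.sub (.sub (.get 0 (.add (.var 13) (.var 6)))
            (.get 2 (.var 5))) (.get 2 (.var 6)))))
          (.setR 1 (.sub (.sub (.get 0 (.add (.var 13) (.var 6)))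
            (.get 2 (.var 5))) (.get 2 (.var 6))))))
      (.ite (.and (.natLe (.const 1) (.var 9)) (.realLe (.var 0) (.var 1))) .skip
        (.seq (.setR 0 (.var 1)) (.seq (.setN 7 (.var 5)) (.seq (.setN 8 (.var 6))
          (.setN 9 (.const 1)))))))
    .skip

/-- The registers hold the next one among the events with the property `P`. -/
def Best (I : Inst (Fin n)) (st : Moat (Fin n)) (P : Fin n → Fin n → Prop) (s : Mem) : Prop :=
  (s.ivar 9 = 0 ∧ ∀ u v, P u v → ¬ st.Valid u v) ∨
    s.ivar 9 = 1 ∧ ∃ bu bv, st.Valid bu bv ∧ s.ivar 7 = bu ∧ s.ivar 8 = bv ∧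
      s.rvar 0 = st.delay I bu bv ∧ ∀ u v, P u v → st.Valid u v → s.rvar 0 ≤ st.delay I u v

theorem Best.congr {P P' : Fin n → Fin n → Prop} {s' : Mem} (h : Best I st P s)
    (hP : ∀ u v, P' u v → P u v) (h7 : s'.ivar 7 = s.ivar 7) (h8 : s'.ivar 8 = s.ivar 8)
    (h9 : s'.ivar 9 = s.ivar 9) (h0 : s'.rvar 0 = s.rvar 0) : Best I st P' s' := by
  rw [Best, h7, h8, h9, h0]
  rcases h with ⟨h1, h2⟩ | ⟨h1, bu, bv, h2, h3, h4, h5, h6⟩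
  · exact .inl ⟨h1, fun u v h => h2 u v (hP u v h)⟩
  · exact .inr ⟨h1, bu, bv, h2, h3, h4, h5, fun u v h => h6 u v (hP u v h)⟩

/-- Here `P` describes the events seen so far and `P'` may add `uv`. Either `uv` is valid and beats
the stored event (`new`), or the registers stay (`keep`). Register `13` carries `u * n`, as naturals
cannot be multiplied. -/
theorem wp_scanBody (h : Rep I st s) {u v : Fin n} (hu : s.ivar 5 = u) (hv : s.ivar 6 = v)
    (hun : s.ivar 13 = u * n) {P P' : Fin n → Fin n → Prop} (hb : Best I st P s)
    (hP : ∀ x y, P' x y → P x y ∨ (x = u ∧ y = v)) :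
    wp scanBody (fun t s' => t ≤ 100 ∧ s'.iarr = s.iarr ∧ s'.rarr = s.rarr ∧
      (∀ r, r ≠ 7 → r ≠ 8 → r ≠ 9 → s'.ivar r = s.ivar r) ∧ Best I st P' s') s := by
  have e1 := h.dead_lab u
  have e2 := h.dead_lab v
  have e3 : (u : ℕ) = v ↔ u = v := Fin.ext_iff.symm
  have e4 : (st.lab u : ℕ) = st.lab v ↔ st.lab u = st.lab v := Fin.ext_iff.symm
  have old : st.Valid u v ∧ s.ivar 9 = 0 ∨ st.Valid u v ∧ ¬ s.rvar 0 ≤ st.delay I u v ∨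
      Best I st P' s := by
    rcases hb with ⟨h1, h2⟩ | ⟨h1, bu, bv, h2, h3, h4, h5, h6⟩
    · by_cases hval : st.Valid u v
      · exact .inl ⟨hval, h1⟩
      · refine .inr (.inr (.inl ⟨h1, fun x y hxy => ?_⟩))
        rcases hP x y hxy with hp | ⟨rfl, rfl⟩
        · exact h2 x y hp
        · exact hval
    · by_cases hval : st.Valid u v ∧ ¬ s.rvar 0 ≤ st.delay I u v
      · exact .inr (.inl hval)
      · refine .inr (.inr (.inr ⟨h1, bu, bv, h2, h3, h4, h5, fun x y hxy hxv => ?_⟩))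
        rcases hP x y hxy with hp | ⟨rfl, rfl⟩
        · exact h6 x y hp hxv
        · by_contra hcon
          exact hval ⟨hxv, hcon⟩
  have new : st.Valid u v → ¬ (1 ≤ s.ivar 9 ∧ s.rvar 0 ≤ st.delay I u v) → ∀ s' : Mem,
      s'.ivar 7 = u → s'.ivar 8 = v → s'.ivar 9 = 1 → s'.rvar 0 = st.delay I u v →
      Best I st P' s' := by
    intro hval hnew s' g7 g8 g9 g0
    refine .inr ⟨g9, u, v, hval, g7, g8, g0, fun x y hxy hv => ?_⟩
    rw [g0]
    rcases hP x y hxy with hp | ⟨rfl, rfl⟩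
    · rcases hb with ⟨h1, h2⟩ | ⟨h1, bu, bv, h2, h3, h4, h5, h6⟩
      · exact absurd hv (h2 x y hp)
      · have := h6 x y hp hv
        have h7 : ¬ s.rvar 0 ≤ st.delay I u v := fun h7 => hnew ⟨h1.ge, h7⟩
        linarith
    · exact le_rfl
  have keep : (¬ st.Valid u v ∨ (1 ≤ s.ivar 9 ∧ s.rvar 0 ≤ st.delay I u v)) → ∀ s' : Mem,
      s'.ivar = s.ivar → s'.rvar 0 = s.rvar 0 → Best I st P' s' := by
    intro hk s' g g0
    have hold : Best I st P' s := by
      rcases old with ⟨o1, o2⟩ | ⟨o1, o2⟩ | o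
      · rcases hk with hk | hk
        · exact absurd o1 hk
        · omega
      · rcases hk with hk | hk
        · exact absurd o1 hk
        · exact absurd hk.2 o2
      · exact o
    exact hold.congr (fun _ _ => id) (by rw [g]) (by rw [g]) (by rw [g]) g0
  simp only [scanBody, wp_ite, BExpr.Holds, BExpr.natEq_holds, NExpr.eval, hu, hv, e1, e3]
  rw [h.lab, h.lab, e4]
  have hval : ((if st.lab u ∈ st.act then 0 else 1) ≤ 0 ∧ ¬ (st.lab u = st.lab v ∧ ¬ u = v)) ↔
      st.Valid u v := by
    rw [Moat.Valid]
    by_cases a : st.lab u ∈ st.act <;> simp [a]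
  rw [hval]
  refine ⟨fun hV => ?_, fun hV => ?_⟩
  · rw [wp_seq]
    have cand : wp
        (.ite (.natEq (.var 5) (.var 6))
          (.setR 1 (.get 1 (.get 2 (.var 5))))
          (.ite (.natLe (.get 3 (.get 2 (.var 6))) (.const 0))
            (.setR 1 (.smul (1 / 2) (.sub (.sub (.get 0 (.add (.var 13) (.var 6)))
              (.get 2 (.var 5))) (.get 2 (.var 6)))))
            (.setR 1 (.sub (.sub (.get 0 (.add (.var 13) (.var 6)))
              (.get 2 (.var 5))) (.get 2 (.var 6))))))
        (fun t s' => t ≤ 40 ∧ s' = s.setR 1 (st.delay I u v)) s := by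
      simp only [wp_ite, wp_setR, BExpr.Holds, BExpr.natEq_holds, BExpr.natEq_cost, BExpr.cost,
        NExpr.eval, RExpr.eval, NExpr.cost, RExpr.cost, hu, hv, e2, e3, hun]
      rw [h.lab, h.w, h.p, h.d, h.d, Moat.delay]
      by_cases a1 : u = v
      · simp [a1]
      · by_cases a2 : st.lab v ∈ st.act <;> simp [a1, a2]
    refine wp_mono cand ?_
    rintro t s' ⟨ht, rfl⟩
    simp only [wp_ite, wp_seq, wp_setR, wp_setN, wp_skip, BExpr.Holds, NExpr.eval, RExpr.eval,
      Mem.setR_ivar, Mem.setN_ivar, Mem.setR_rvar, Mem.setR_rarr, Mem.setN_rarr,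
      Mem.setR_iarr, Mem.setN_iarr, BExpr.cost, NExpr.cost, RExpr.cost, BExpr.natEq_cost, hu]
    simp only [Function.update_self, Function.update_of_ne (zero_ne_one : (0 : ℕ) ≠ 1)]
    refine ⟨fun hk => ⟨by omega, trivial, trivial, fun _ _ _ _ => trivial, ?_⟩,
      fun hk => ⟨by omega, trivial, trivial, fun r r7 r8 r9 => ?_, ?_⟩⟩
    · exact keep (.inr hk) _ rfl rfl
    · simp [r7, r8, r9]
    · refine new hV hk _ ?_ ?_ ?_ ?_ <;> simp [Mem.setN_ivar, Mem.setN_rvar, Mem.setR_rvar, hv]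
  · rw [wp_skip]
    exact ⟨by simp [BExpr.cost, BExpr.natEq_cost, NExpr.cost], rfl, rfl, fun _ _ _ _ => rfl,
      keep (.inl hV) s rfl rfl⟩

/-- Find the next event. -/
def scanCmd : Cmd :=
  .seq (.setN 9 (.const 0)) (.seq (.setN 13 (.const 0))
    (.loop 5 (.seq (.loop 6 scanBody) (.setN 13 (.add (.var 13) (.var 0))))))

/-- The pairs are visited in lexicographic order, and the events seen so far form an initial segment
of it. -/
theorem wp_scanCmd (h : Rep I st s) :
    wp scanCmd (fun t s' => t ≤ (n + 1) * ((n + 1) * 110 + 6 + 10) + 6 ∧ s'.iarr = s.iarr ∧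
      s'.rarr = s.rarr ∧
      (∀ r, r ≠ 5 → r ≠ 6 → r ≠ 7 → r ≠ 8 → r ≠ 9 → r ≠ 13 → s'.ivar r = s.ivar r) ∧
      Best I st (fun _ _ => True) s') s := by
  rw [scanCmd, wp_seq, wp_setN, wp_seq, wp_setN]
  simp only [NExpr.eval, NExpr.cost]
  let R : Mem → Prop := fun s' => s'.iarr = s.iarr ∧ s'.rarr = s.rarr ∧
    ∀ r, r ≠ 5 → r ≠ 6 → r ≠ 7 → r ≠ 8 → r ≠ 9 → r ≠ 13 → s'.ivar r = s.ivar r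
  have hR : ∀ s', R s' → Rep I st s' := fun s' hs' =>
    h.congr (hs'.2.2 0 (by simp) (by simp) (by simp) (by simp) (by simp) (by simp))
      (by rw [hs'.1]) (by rw [hs'.1]) hs'.2.1
  refine wp_mono (wp_loop (n := n) (T := (n + 1) * 110 + 6) (Inv := fun k s' => R s' ∧
    s'.ivar 5 = k ∧ s'.ivar 13 = k * n ∧ Best I st (fun u _ => u.val < k) s') ?_ ?_ ?_) ?_
  · refine ⟨⟨rfl, rfl, fun r r5 r6 r7 r8 r9 r13 => ?_⟩, ?_, ?_, .inl ⟨?_, ?_⟩⟩ <;>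
    simp [Mem.setN_ivar, *]
  · rintro k s' ⟨h1, h2, -⟩
    exact ⟨(hR s' h1).n_eq, h2⟩
  · rintro k hk s₁ ⟨h1, h2, h3, h4⟩
    rw [wp_seq]
    refine wp_mono (wp_loop (n := n) (T := 100) (Inv := fun j s' => R s' ∧ s'.ivar 5 = k ∧
      s'.ivar 13 = k * n ∧ s'.ivar 6 = j ∧
      Best I st (fun u v => u.val < k ∨ u.val = k ∧ v.val < j) s') ?_ ?_ ?_) ?_
    · refine ⟨⟨h1.1, h1.2.1, fun r r5 r6 r7 r8 r9 r13 => ?_⟩, ?_, ?_, ?_,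
        h4.congr (fun u v huv => ?_) ?_ ?_ ?_ rfl⟩
      · simp [Mem.setN_ivar, *, h1.2.2 r]
      · simp [Mem.setN_ivar, *]
      · simp [Mem.setN_ivar, *]
      · simp [Mem.setN_ivar, *]
      · simpa using huv
      all_goals simp [Mem.setN_ivar]
    · rintro j s' ⟨g1, -, -, g2, -⟩
      exact ⟨(hR s' g1).n_eq, g2⟩
    · rintro j hj s₂ ⟨g1, g2, g3, g4, g5⟩
      refine wp_mono (wp_scanBody (P' := fun u v => u.val < k ∨ u.val = k ∧ v.val < j + 1) (hR _ g1)
        (u := ⟨k, hk⟩) (v := ⟨j, hj⟩) g2 g4 g3 g5 ?_) ?_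
      · intro x y hxy
        simp only [Fin.ext_iff]
        omega
      · rintro t s₃ ⟨ht, f1, f2, f3, f4⟩
        have f6 : s₃.ivar 6 = j := by rw [f3 6 (by simp) (by simp) (by simp), g4]
        refine ⟨ht, f6, ⟨f1.trans g1.1, f2.trans g1.2.1, fun r r5 r6 r7 r8 r9 r13 => ?_⟩, ?_, ?_,
          ?_, f4.congr (fun _ _ => id) ?_ ?_ ?_ rfl⟩
        · rw [Mem.setN_ivar, Function.update_of_ne r6, f3 r r7 r8 r9, g1.2.2 r r5 r6 r7 r8 r9 r13]
        · simp [Mem.setN_ivar, f3, g2]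
        · simp [Mem.setN_ivar, f3, g3]
        all_goals simp [Mem.setN_ivar]
    · rintro t s₂ ⟨ht, g1, g2, g3, g4, g5⟩
      rw [wp_setN]
      simp only [NExpr.cost, NExpr.eval, g3, (hR _ g1).n_eq]
      refine ⟨by omega, ?_, ⟨g1.1, g1.2.1, fun r r5 r6 r7 r8 r9 r13 => ?_⟩, ?_, ?_,
        g5.congr (fun u v huv => ?_) ?_ ?_ ?_ rfl⟩
      · simp [Mem.setN_ivar, g2]
      · simp [Mem.setN_ivar, *, g1.2.2 r]
      · simp [Mem.setN_ivar]
      · simp [Mem.setN_ivar, add_mul]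
      · have := v.isLt
        omega
      all_goals simp [Mem.setN_ivar]
  · rintro t s₁ ⟨ht, h1, h2, h3, h4⟩
    exact ⟨by omega, h1.1, h1.2.1, h1.2.2, h4.congr (fun u _ _ => u.isLt) rfl rfl rfl rfl⟩

/-! ### Merging -/

/-- Give the vertices with the label in register `11` the label in register `10`, and record these
vertices in the natural array `12`, from the cell in register `4` on. -/
def relabelCmd : Cmd :=
  .loop 14 (.ite (.natEq (.get 2 (.var 14)) (.var 11))
    (.seq (.putN 2 (.var 14) (.var 10)) (.putN 12 (.add (.var 4) (.var 14)) (.const 1))) .skip)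

/-- Only ones are written into the membership record; the zeros are those guaranteed by `hfresh`. -/
theorem wp_relabelCmd (h0 : s.ivar 0 = n) {lab : Fin n → Fin n} {c₁ c₂ : Fin n}
    (hlab : ∀ x : Fin n, s.iarr 2 x = lab x) (h1 : s.ivar 10 = c₁) (h2 : s.ivar 11 = c₂) {q : ℕ}
    (h4 : s.ivar 4 = q) (hfresh : ∀ j, q ≤ j → s.iarr 12 j = 0) :
    wp relabelCmd (fun t s' => t ≤ (n + 1) * 40 + 2 ∧
      (∀ x : Fin n, s'.iarr 2 x = if lab x = c₂ then c₁ else lab x) ∧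
      (∀ x : Fin n, s'.iarr 12 (q + x) = if lab x = c₂ then 1 else 0) ∧
      (∀ j < q, s'.iarr 12 j = s.iarr 12 j) ∧ (∀ j, q + n ≤ j → s'.iarr 12 j = 0) ∧
      (∀ a, a ≠ 2 → a ≠ 12 → s'.iarr a = s.iarr a) ∧ s'.rarr = s.rarr ∧
      ∀ r, r ≠ 14 → s'.ivar r = s.ivar r) s := by
  refine wp_mono (wp_loop (n := n) (T := 30) (Inv := fun k s' =>
    (∀ x : Fin n, s'.iarr 2 x = if x.val < k ∧ lab x = c₂ then c₁ else lab x) ∧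
    (∀ x : Fin n, x.val < k → s'.iarr 12 (q + x) = if lab x = c₂ then 1 else 0) ∧
    (∀ j < q, s'.iarr 12 j = s.iarr 12 j) ∧ (∀ j, q + k ≤ j → s'.iarr 12 j = 0) ∧
    (∀ a, a ≠ 2 → a ≠ 12 → s'.iarr a = s.iarr a) ∧ s'.rarr = s.rarr ∧
    (∀ r, r ≠ 14 → s'.ivar r = s.ivar r) ∧ s'.ivar 14 = k) ?_ ?_ ?_) ?_
  · refine ⟨fun x => ?_, fun x hx => absurd hx (Nat.not_lt_zero _), fun j _ => rfl,
      fun j hj => hfresh j hj, fun a _ _ => rfl, rfl, fun r hr => ?_, ?_⟩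
    · simpa [Mem.setN_iarr] using hlab x
    · simp [Mem.setN_ivar, hr]
    · simp [Mem.setN_ivar]
  · rintro k s' ⟨-, -, -, -, -, -, h7, h8⟩
    exact ⟨(h7 0 (by simp)).trans h0, h8⟩
  · rintro k hk s' ⟨g1, g2, g3, g4, g5, g6, g7, g8⟩
    have e1 : s'.iarr 2 k = lab ⟨k, hk⟩ := by simpa using g1 ⟨k, hk⟩
    have e2 : s'.ivar 11 = c₂ := (g7 11 (by simp)).trans h2
    have e3 : s'.ivar 10 = c₁ := (g7 10 (by simp)).trans h1
    have e4 : s'.ivar 4 = q := (g7 4 (by simp)).trans h4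
    simp only [wp_ite, wp_seq, wp_putN, wp_skip, BExpr.natEq_holds, BExpr.natEq_cost, NExpr.eval,
      NExpr.cost, g8, e1, e2, e3, e4, Fin.val_inj, Mem.putN_ivar]
    refine ⟨fun hc => ⟨by norm_num, trivial, fun x => ?_, fun x hx => ?_, fun j hj => ?_,
      fun j hj => ?_, fun a a2 a12 => ?_, g6, fun r hr => ?_, ?_⟩,
      fun hc => ⟨by norm_num, trivial, fun x => ?_, fun x hx => ?_, g3,
      fun j hj => g4 j (by omega), g5, g6, fun r hr => ?_, ?_⟩⟩
    · by_cases hx : x.val = k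
      · have : x = ⟨k, hk⟩ := Fin.ext hx
        subst this
        simp [Mem.setN_iarr, Mem.putN_iarr, hc]
      · have e : x.val < k + 1 ↔ x.val < k := by omega
        simp [Mem.setN_iarr, Mem.putN_iarr, hx, g1, e]
    · by_cases hxk : x.val = k
      · have : x = ⟨k, hk⟩ := Fin.ext hxk
        subst this
        simp [Mem.setN_iarr, Mem.putN_iarr, hc]
      · simp [Mem.setN_iarr, Mem.putN_iarr, hxk, g2 x (by omega)]
    · have : j ≠ q + k := by omega
      simp [Mem.setN_iarr, Mem.putN_iarr, this, g3 j hj]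
    · have : j ≠ q + k := by omega
      simp [Mem.setN_iarr, Mem.putN_iarr, this, g4 j (by omega)]
    · simp [Mem.setN_iarr, Mem.putN_iarr, a2, a12, g5]
    · simp [Mem.setN_ivar, Mem.putN_ivar, hr, g7]
    · simp [Mem.setN_ivar]
    · rw [Mem.setN_iarr, g1]
      by_cases hx : x.val = k
      · have : x = ⟨k, hk⟩ := Fin.ext hx
        subst this
        simp [hc]
      · have e : x.val < k + 1 ↔ x.val < k := by omega
        simp [e]
    · rw [Mem.setN_iarr]
      by_cases hxk : x.val = k
      · have : x = ⟨k, hk⟩ := Fin.ext hxk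
        subst this
        simp [hc, g4]
      · exact g2 x (by omega)
    · simp [Mem.setN_ivar, hr, g7]
    · simp [Mem.setN_ivar]
  · rintro t s' ⟨ht, g1, g2, g3, g4, g5, g6, g7, -⟩
    exact ⟨ht, fun x => by simpa using g1 x, fun x => g2 x x.isLt, g3, g4, g5, g6, g7⟩

/-! ### The growth phase -/

/-- The natural arrays `7` to `12` hold the list of the merges. -/
def Log : List (Fin n × Fin n × Moat (Fin n)) → (ℕ → ℕ → ℕ) → Prop
  | [], _ => True
  | (u, v, st) :: l, A => A 7 l.length = u ∧ A 8 l.length = v ∧ A 9 l.length = st.lab u ∧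
      A 10 l.length = st.lab v ∧ A 11 l.length = (if st.lab v ∈ st.act then 0 else 1) ∧
      (∀ x : Fin n, A 12 (l.length * n + x) = if st.lab x = st.lab v then 1 else 0) ∧ Log l A

/-- Only cells below the current length matter, so appending a record does not disturb earlier ones.
-/
theorem Log.congr {l : List (Fin n × Fin n × Moat (Fin n))} {A B : ℕ → ℕ → ℕ} (h : Log l A)
    (h1 : ∀ a, 7 ≤ a → a ≤ 11 → ∀ k < l.length, B a k = A a k)
    (h2 : ∀ k < l.length * n, B 12 k = A 12 k) : Log l B := by
  induction l with
  | nil => trivial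
  | cons e l ih =>
    obtain ⟨u, v, st⟩ := e
    rw [List.length_cons] at h1 h2
    obtain ⟨g1, g2, g3, g4, g5, g6, g7⟩ := h
    have hlt := Nat.lt_succ_self l.length
    refine ⟨?_, ?_, ?_, ?_, ?_, fun x => ?_, ih g7 (fun a a1 a2 k hk => h1 a a1 a2 k (by omega))
      fun k hk => h2 k (by rw [add_mul]; omega)⟩
    · rw [h1 7 (by simp) (by simp) _ hlt, g1]
    · rw [h1 8 (by simp) (by simp) _ hlt, g2]
    · rw [h1 9 (by simp) (by simp) _ hlt, g3]
    · rw [h1 10 (by simp) (by simp) _ hlt, g4]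
    · rw [h1 11 (by simp) (by simp) _ hlt, g5]
    · rw [h2 _ (by rw [add_mul]; have := x.isLt; omega), g6]

/-- The invariant of the growth phase. -/
structure Fwd (I : Inst (Fin n)) (m : ℕ) (st : Moat (Fin n))
    (l : List (Fin n × Fin n × Moat (Fin n))) (y : ℝ) (s : Mem) : Prop where
  rep : Rep I st s
  good : st.Good I
  hist : Moat.Hist I m l st y
  log : Log l s.iarr
  m_eq : s.ivar 1 = m
  a_eq : s.ivar 2 = st.act.card
  k_eq : s.ivar 3 = l.length
  q_eq : s.ivar 4 = l.length * n
  fresh : ∀ j, l.length * n ≤ j → s.iarr 12 j = 0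
  nxt : ∀ x : Fin n, s.iarr 4 x = x
  kept : s.iarr 5 = 0
  touched : s.iarr 6 = 0
  le : m ≤ st.act.card

/-- Perform the merge given by the registers `7` and `8`. -/
def mergeCmd : Cmd :=
  .seq (.setN 10 (.get 2 (.var 7))) (.seq (.setN 11 (.get 2 (.var 8)))
  (.seq (.putN 7 (.var 3) (.var 7)) (.seq (.putN 8 (.var 3) (.var 8))
  (.seq (.putN 9 (.var 3) (.var 10)) (.seq (.putN 10 (.var 3) (.var 11))
  (.seq (.putN 11 (.var 3) (.get 3 (.var 11)))
  (.seq (.putR 1 (.var 10) (.add (.get 1 (.var 10)) (.get 1 (.var 11))))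
  (.seq (.setN 2 (.sub (.add (.var 2) (.get 3 (.var 11))) (.const 1)))
  (.seq (.putN 3 (.var 11) (.const 1)) (.seq relabelCmd
  (.seq (.setN 3 (.add (.var 3) (.const 1))) (.setN 4 (.add (.var 4) (.var 0))))))))))))))

/-- Grow until the next event, and perform this event. -/
def stepCmd : Cmd :=
  .seq scanCmd (.seq growCmd (.ite (.natEq (.var 7) (.var 8))
    (.seq (.putN 3 (.get 2 (.var 7)) (.const 1)) (.setN 2 (.sub (.var 2) (.const 1)))) mergeCmd))

/-- A bound on the number of the remaining events. -/
def Moat.fuel (st : Moat (Fin n)) : ℕ := st.act.card + (univ.filter fun c => st.lab c = c).card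

/-- The label of `v` is lost and no new label arises. -/
theorem Moat.card_labels_merge (h : st.Good I) {u v : Fin n} (huv : st.lab u ≠ st.lab v) :
    (univ.filter fun c => (st.merge u v).lab c = c).card <
      (univ.filter fun c => st.lab c = c).card := by
  refine card_lt_card ⟨fun c hc => ?_, fun hsub => ?_⟩
  · simp only [mem_filter, mem_univ, true_and, merge_lab_eq_self h huv] at hc ⊢
    exact hc.1
  · have := hsub (x := st.lab v) (by simp [h.idem])
    simp [merge_lab_eq_self h huv] at this

theorem Moat.fuel_merge (h : st.Good I) {u v : Fin n} (huv : st.lab u ≠ st.lab v) :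
    (st.merge u v).fuel < st.fuel :=
  Nat.add_lt_add_of_le_of_lt (card_le_card (erase_subset _ _)) (card_labels_merge h huv)

theorem Moat.fuel_kill {c : Fin n} (hc : c ∈ st.act) : (st.kill c).fuel < st.fuel := by
  have := card_erase_lt_of_mem hc
  exact Nat.add_lt_add_right this _

theorem wp_mergeCmd {l : List (Fin n × Fin n × Moat (Fin n))} {y : ℝ} (h : Fwd I m st l y s)
    {u v : Fin n} (hu : s.ivar 7 = u) (hv : s.ivar 8 = v) (huv : st.lab u ≠ st.lab v)
    (hact : st.lab u ∈ st.act) (hw : I.w s(u, v) = st.d u + st.d v) (hm : m < st.act.card) :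
    wp mergeCmd (fun t s' => t ≤ (n + 1) * 40 + 60 ∧
      Fwd I m (st.merge u v) ((u, v, st) :: l) y s') s := by
  have e1 : s.iarr 2 u = st.lab u := h.rep.lab u
  have e2 : s.iarr 2 v = st.lab v := h.rep.lab v
  have e3 := h.rep.dead (st.lab v)
  have e4 := h.rep.p (st.lab u)
  have e5 := h.rep.p (st.lab v)
  simp only [mergeCmd, wp_seq, wp_setN, wp_putN, wp_putR, NExpr.eval, NExpr.cost, RExpr.eval,
    RExpr.cost, Mem.setN_ivar, Mem.setN_iarr, Mem.setN_rarr, Mem.putN_ivar, Mem.putN_iarr,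
    Mem.putN_rarr, Mem.putR_ivar, Mem.putR_iarr]
  simp +decide only [Function.update_self, Function.update_of_ne, ne_eq,
    hu, hv, e1, e2, e3, e4, e5, h.k_eq, h.a_eq]
  refine wp_mono (wp_relabelCmd (n := n) (lab := st.lab) (c₁ := st.lab u) (c₂ := st.lab v)
    (q := l.length * n) ?_ ?_ ?_ ?_ ?_ ?_) ?_
  · simpa [Mem.setN_ivar, Mem.putN_ivar, Mem.putR_ivar] using h.rep.n_eq
  · simpa [Mem.setN_iarr, Mem.putN_iarr, Mem.putR_iarr] using h.rep.lab
  · simp [Mem.setN_ivar, Mem.putN_ivar, Mem.putR_ivar]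
  · simp [Mem.setN_ivar, Mem.putN_ivar, Mem.putR_ivar]
  · simpa [Mem.setN_ivar, Mem.putN_ivar, Mem.putR_ivar] using h.q_eq
  · simpa [Mem.setN_iarr, Mem.putN_iarr, Mem.putR_iarr] using h.fresh
  rintro t s' ⟨ht, g1, g2, g3, g4, g5, g6, g7⟩
  simp only [Mem.setN_ivar, Mem.putN_ivar, Mem.putR_ivar, Mem.setN_iarr, Mem.putN_iarr,
    Mem.putR_iarr, Mem.setN_rarr, Mem.putN_rarr, Mem.putR_rarr] at g3 g5 g6 g7
  have r0 : s'.ivar 0 = n := by simpa using (g7 0 (by simp)).trans h.rep.n_eq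
  have r1 : s'.ivar 1 = m := by simpa using (g7 1 (by simp)).trans h.m_eq
  have r2 := g7 2 (by simp)
  have r3 := g7 3 (by simp)
  have r4 := g7 4 (by simp)
  have f3 := g5 3 (by simp) (by simp)
  have f4 := g5 4 (by simp) (by simp)
  have f5 := g5 5 (by simp) (by simp)
  have f6 := g5 6 (by simp) (by simp)
  have f7 := g5 7 (by simp) (by simp)
  have f8 := g5 8 (by simp) (by simp)
  have f9 := g5 9 (by simp) (by simp)
  have f10 := g5 10 (by simp) (by simp)
  have f11 := g5 11 (by simp) (by simp)
  clear g5 g7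
  simp +decide only [Function.update_self, Function.update_of_ne, ne_eq]
    at g3 r2 r3 r4 f3 f4 f5 f6 f7 f8 f9 f10 f11
  have hdead : ∀ x : Fin n, s'.iarr 3 x = if x ∈ (st.merge u v).act then 0 else 1 := by
    intro x
    rw [f3, Function.update_apply, h.rep.dead]
    simp only [Moat.merge, mem_erase, Fin.val_inj]
    by_cases hx : x = st.lab v <;> simp [hx]
  -- The inactivity flag of `v` decides whether an active component is lost. Adding it before
  -- subtracting 1 makes one formula serve both cases.
  have hcard : (st.merge u v).act.card = (st.act.card + if st.lab v ∈ st.act then 0 else 1) - 1 := by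
    by_cases hx : st.lab v ∈ st.act
    · simp [Moat.merge, hx]
    · simp [Moat.merge, hx]
  refine ⟨by omega, ⟨⟨?_, g1, hdead, ?_, fun x => ?_, ?_⟩, h.good.merge huv hact,
    .merge h.hist h.good huv hact hw, ⟨?_, ?_, ?_, ?_, ?_, g2, ?_⟩, ?_, ?_, ?_, ?_, fun j hj => ?_,
    ?_, ?_, ?_, ?_⟩⟩
  · simpa [Mem.setN_ivar] using r0
  · rw [Mem.setN_rarr, Mem.setN_rarr, g6]
    simpa using h.rep.w
  · rw [Mem.setN_rarr, Mem.setN_rarr, g6]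
    simp only [Function.update_self, Function.update_apply, Moat.merge, h.rep.p, Fin.val_inj]
  · rw [Mem.setN_rarr, Mem.setN_rarr, g6]
    simpa [Moat.merge] using h.rep.d
  · simp [Mem.setN_iarr, f7]
  · simp [Mem.setN_iarr, f8]
  · simp [Mem.setN_iarr, f9]
  · simp [Mem.setN_iarr, f10]
  · simp [Mem.setN_iarr, f11]
  · refine h.log.congr (fun a a1 a2 k hk => ?_) g3
    have hk' : k ≠ l.length := hk.ne
    rw [Mem.setN_iarr, Mem.setN_iarr]
    interval_cases a
    · rw [f7, Function.update_of_ne hk']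
    · rw [f8, Function.update_of_ne hk']
    · rw [f9, Function.update_of_ne hk']
    · rw [f10, Function.update_of_ne hk']
    · rw [f11, Function.update_of_ne hk']
  · simpa [Mem.setN_ivar] using r1
  · simpa [Mem.setN_ivar, hcard] using r2
  · simp [Mem.setN_ivar, r3, h.k_eq]
  · simp [Mem.setN_ivar, r4, r0, h.q_eq, add_mul]
  · rw [List.length_cons, add_mul, one_mul] at hj
    exact g4 j hj
  · simpa [Mem.setN_iarr, f4] using h.nxt
  · simpa [Mem.setN_iarr, f5] using h.kept
  · simpa [Mem.setN_iarr, f6] using h.touched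
  · rw [hcard]
    omega

/-- Some active component remains, and its deactivation is always a possible event, so the scan
cannot come back empty. -/
theorem Moat.Valid.exists_of_card (h : st.Good I) (hm : m < st.act.card) :
    ∃ c, st.Valid c c := by
  obtain ⟨c, hc⟩ := card_pos.1 (Nat.zero_lt_of_lt hm)
  exact ⟨c, by rwa [h.lab_act c hc], fun _ => rfl⟩

/-- Growing by the least delay keeps the invariants and makes the chosen event due: a residual
penalty reaches zero or an edge becomes tight. An event removes at most one active component, so
their number cannot jump below `m`. -/
theorem wp_stepCmd {l : List (Fin n × Fin n × Moat (Fin n))} {y : ℝ} (h : Fwd I m st l y s)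
    (hm : m < st.act.card) :
    wp stepCmd (fun t s' => t ≤ (n + 1) * ((n + 1) * 110 + 100) + 100 ∧
      ∃ st' l' y', st'.fuel < st.fuel ∧ Fwd I m st' l' y' s') s := by
  rw [stepCmd, wp_seq]
  refine wp_mono (wp_scanCmd h.rep) ?_
  rintro t₁ s₁ ⟨ht₁, i₁, r₁, v₁, hb⟩
  obtain ⟨u, v, hval, hu, hv, hδ, hmin⟩ : ∃ u v, st.Valid u v ∧ s₁.ivar 7 = u ∧ s₁.ivar 8 = v ∧
      s₁.rvar 0 = st.delay I u v ∧ ∀ x z, st.Valid x z → st.delay I u v ≤ st.delay I x z := by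
    rcases hb with ⟨-, h2⟩ | ⟨-, bu, bv, h2, h3, h4, h5, h6⟩
    · obtain ⟨c, hc⟩ := Moat.Valid.exists_of_card h.good hm
      exact absurd hc (h2 c c trivial)
    · exact ⟨bu, bv, h2, h3, h4, h5, fun x z hxz => h5 ▸ h6 x z trivial hxz⟩
  have hrep₁ : Rep I st s₁ := h.rep.congr (v₁ 0 (by simp) (by simp) (by simp) (by simp) (by simp)
    (by simp)) (by rw [i₁]) (by rw [i₁]) r₁
  rw [wp_seq]
  refine wp_mono (wp_growCmd hrep₁ hδ) ?_
  rintro t₂ s₂ ⟨ht₂, hrep₂, i₂, v₂⟩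
  set δ := st.delay I u v with hδ'
  have hv₂ : ∀ r, r < 5 → s₂.ivar r = s.ivar r := fun r hr => by
    rw [v₂ r (by omega), v₁ r (by omega) (by omega) (by omega) (by omega) (by omega) (by omega)]
  have hi₂ : s₂.iarr = s.iarr := i₂.trans i₁
  have hf : Fwd I m (st.grow δ) l (y + δ * (st.act.card - m)) s₂ :=
    { rep := hrep₂
      good := h.good.grow_delay hmin
      hist := .grow h.hist h.good (Moat.delay_nonneg h.good hval)
      log := hi₂ ▸ h.log
      m_eq := (hv₂ 1 (by simp)).trans h.m_eq
      a_eq := (hv₂ 2 (by simp)).trans h.a_eq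
      k_eq := (hv₂ 3 (by simp)).trans h.k_eq
      q_eq := (hv₂ 4 (by simp)).trans h.q_eq
      fresh := hi₂ ▸ h.fresh
      nxt := hi₂ ▸ h.nxt
      kept := hi₂ ▸ h.kept
      touched := hi₂ ▸ h.touched
      le := h.le }
  have hu₂ : s₂.ivar 7 = u := (v₂ 7 (by simp)).trans hu
  have hv₂' : s₂.ivar 8 = v := (v₂ 8 (by simp)).trans hv
  rw [wp_ite]
  simp only [BExpr.natEq_holds, NExpr.eval, hu₂, hv₂', Fin.val_inj, BExpr.natEq_cost, NExpr.cost]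
  refine ⟨fun huv => ?_, fun huv => ?_⟩
  · subst huv
    simp only [wp_seq, wp_putN, wp_setN, NExpr.eval, NExpr.cost, Mem.putN_ivar, hu₂, hrep₂.lab]
    have hact : st.lab u ∈ (st.grow δ).act := hval.1
    have hcard : ((st.grow δ).kill (st.lab u)).act.card = st.act.card - 1 :=
      card_erase_of_mem hact
    have hzero : (st.grow δ).p (st.lab u) = 0 := by
      simp [Moat.grow, hval.1, hδ', Moat.delay]
    refine ⟨by nlinarith, (st.grow δ).kill (st.lab u), l, _, Moat.fuel_kill hact,
      { rep := ⟨?_, ?_, fun x => ?_, hrep₂.w, hrep₂.p, hrep₂.d⟩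
        good := hf.good.kill hzero
        hist := .kill _ hf.hist
        log := hf.log.congr (fun a a1 a2 k hk => ?_) fun k hk => ?_
        m_eq := ?_
        a_eq := ?_
        k_eq := ?_
        q_eq := ?_
        fresh := ?_
        nxt := ?_
        kept := ?_
        touched := ?_
        le := ?_ }⟩
    · simpa [Mem.setN_ivar, Mem.putN_ivar] using hrep₂.n_eq
    · simpa [Mem.setN_iarr, Mem.putN_iarr, Moat.kill] using hrep₂.lab
    · simp only [Mem.setN_iarr, Mem.putN_iarr, Function.update_self, Function.update_apply,
        hrep₂.dead, Fin.val_inj, Moat.kill, mem_erase]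
      have hlu : (st.grow δ).lab u = st.lab u := rfl
      by_cases hx : x = st.lab u <;> simp [hx, hlu]
    · have : a ≠ 3 := by omega
      simp [Mem.setN_iarr, Mem.putN_iarr, this]
    · simp [Mem.setN_iarr, Mem.putN_iarr]
    · simpa [Mem.setN_ivar, Mem.putN_ivar] using hf.m_eq
    · rw [Mem.setN_ivar, Function.update_self, hcard, hf.a_eq]
      rfl
    · simpa [Mem.setN_ivar, Mem.putN_ivar] using hf.k_eq
    · simpa [Mem.setN_ivar, Mem.putN_ivar] using hf.q_eq
    · simpa [Mem.setN_iarr, Mem.putN_iarr] using hf.fresh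
    · simpa [Mem.setN_iarr, Mem.putN_iarr] using hf.nxt
    · simpa [Mem.setN_iarr, Mem.putN_iarr] using hf.kept
    · simpa [Mem.setN_iarr, Mem.putN_iarr] using hf.touched
    · omega
  · have hlab : st.lab u ≠ st.lab v := fun e => huv (hval.2 e)
    have hw : I.w s(u, v) = (st.grow δ).d u + (st.grow δ).d v := by
      simp only [Moat.grow, hval.1, if_true, hδ', Moat.delay, huv, if_false]
      split_ifs <;> push_cast <;> ring
    refine wp_mono (wp_mergeCmd hf hu₂ hv₂' hlab hval.1 hw hm) ?_
    rintro t₃ s₃ ⟨ht₃, hf₃⟩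
    exact ⟨by nlinarith, _, _, _, Moat.fuel_merge hf.good hlab, hf₃⟩

/-- Initialize the labels and the tours. -/
def initCmd : Cmd :=
  .seq (.loop 14 (.seq (.putN 2 (.var 14) (.var 14)) (.putN 4 (.var 14) (.var 14))))
    (.setN 2 (.var 0))

/-- Grow until the number of active components is `m`. -/
def phaseCmd : Cmd :=
  .seq initCmd (.while (.natLe (.add (.var 1) (.const 1)) (.var 2)) stepCmd)

theorem wp_initCmd (hm : m ≤ n) :
    wp initCmd (fun t s => t ≤ (n + 1) * 30 + 4 ∧ Fwd I m (Moat.init I) [] 0 s) (loadMem I m) := by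
  rw [initCmd, wp_seq]
  refine wp_mono (wp_loop (n := n) (T := 20) (Inv := fun k s =>
    s.ivar 0 = n ∧ s.ivar 1 = m ∧ s.ivar 3 = 0 ∧ s.ivar 4 = 0 ∧ s.ivar 14 = k ∧
    (∀ x, s.iarr 2 x = if x < k then x else 0) ∧ (∀ x, s.iarr 4 x = if x < k then x else 0) ∧
    (∀ a, a ≠ 2 → a ≠ 4 → s.iarr a = 0) ∧ s.rarr = (loadMem I m).rarr) ?_ ?_ ?_) ?_
  · simp [Mem.setN_ivar, Mem.setN_iarr, Mem.setN_rarr, loadMem]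
    exact fun _ _ _ => rfl
  · rintro k s ⟨h1, -, -, -, h2, -⟩
    exact ⟨h1, h2⟩
  · rintro k hk s ⟨h1, h2, h3, h4, h5, h6, h7, h8, h9⟩
    simp only [wp_seq, wp_putN, NExpr.eval, NExpr.cost, Mem.putN_ivar, h5]
    refine ⟨by norm_num, trivial, ?_, ?_, ?_, ?_, ?_, fun x => ?_, fun x => ?_, fun a a2 a4 => ?_,
      h9⟩
    · simpa [Mem.setN_ivar, Mem.putN_ivar] using h1
    · simpa [Mem.setN_ivar, Mem.putN_ivar] using h2
    · simpa [Mem.setN_ivar, Mem.putN_ivar] using h3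
    · simpa [Mem.setN_ivar, Mem.putN_ivar] using h4
    · simp [Mem.setN_ivar]
    · by_cases hx : x = k
      · simp [Mem.setN_iarr, Mem.putN_iarr, hx]
      · have e : x < k + 1 ↔ x < k := by omega
        simp [Mem.setN_iarr, Mem.putN_iarr, hx, h6, e]
    · by_cases hx : x = k
      · simp [Mem.setN_iarr, Mem.putN_iarr, hx]
      · have e : x < k + 1 ↔ x < k := by omega
        simp [Mem.setN_iarr, Mem.putN_iarr, hx, h7, e]
    · simp [Mem.setN_iarr, Mem.putN_iarr, a2, a4, h8]
  · rintro t s ⟨ht, h1, h2, h3, h4, h5, h6, h7, h8, h9⟩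
    rw [wp_setN]
    simp only [NExpr.eval, NExpr.cost]
    refine ⟨by omega, ⟨?_, fun x => ?_, fun x => ?_, fun x z => ?_, fun x => ?_, fun x => ?_⟩,
      Moat.good_init I, .init, trivial, ?_, ?_, ?_, ?_, fun j _ => ?_, fun x => ?_, ?_, ?_, ?_⟩
    · simpa [Mem.setN_ivar] using h1
    · simp [Mem.setN_iarr, h6, Moat.init]
    · simp [Mem.setN_iarr, h8, Moat.init]
    · have hlt : (x : ℕ) * n + z < n * n := by
        have h1 := x.isLt
        have h2 := z.isLt
        nlinarith
      have hn : 0 < n := x.pos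
      rw [Mem.setN_rarr, h9]
      simp only [loadMem, if_true, dif_pos hlt]
      congr 2
      · refine Fin.ext ?_
        simp only [Fin.coe_divNat]
        rw [mul_comm, Nat.mul_add_div hn, Nat.div_eq_of_lt z.isLt, add_zero]
      · refine Fin.ext ?_
        simp only [Fin.coe_modNat]
        rw [Nat.mul_add_mod_of_lt z.isLt]
    · rw [Mem.setN_rarr, h9]
      simp [loadMem, Moat.init]
    · rw [Mem.setN_rarr, h9]
      simp [loadMem, Moat.init]
    · simpa [Mem.setN_ivar] using h2
    · simp [Mem.setN_ivar, h1, Moat.init]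
    · simpa [Mem.setN_ivar] using h3
    · simpa [Mem.setN_ivar] using h4
    · simp [Mem.setN_iarr, h8]
    · simp [Mem.setN_iarr, h7]
    · simp [Mem.setN_iarr, h8]
    · simp [Mem.setN_iarr, h8]
    · simpa [Moat.init] using hm

/-- Each event lowers `fuel`, which starts at `2 * n`. On exit at most `m` components are active,
and `Fwd.le` turns this into equality. -/
theorem wp_phaseCmd (hm : m ≤ n) :
    wp phaseCmd (fun t s => t ≤ (2 * n + 2) * ((n + 1) * ((n + 1) * 110 + 100) + 120) ∧
      ∃ st l y, Fwd I m st l y s ∧ st.act.card = m) (loadMem I m) := by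
  rw [phaseCmd, wp_seq]
  refine wp_mono (wp_initCmd (I := I) hm) ?_
  rintro t₁ s₁ ⟨ht₁, h₁⟩
  have hfuel : (Moat.init I).fuel = 2 * n := by
    simp [Moat.fuel, Moat.init]
    ring
  refine wp_mono (wp_while (Inv := fun f s => ∃ st l y, st.fuel = f ∧ Fwd I m st l y s)
    (T := (n + 1) * ((n + 1) * 110 + 100) + 100) ⟨_, _, _, hfuel, h₁⟩ ?_) ?_
  · rintro f s ⟨st, l, y, rfl, h⟩ hb
    simp only [BExpr.Holds, NExpr.eval, h.m_eq, h.a_eq] at hb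
    refine wp_mono (wp_stepCmd h hb) ?_
    rintro t s' ⟨ht, st', l', y', hlt, h'⟩
    exact ⟨ht, _, hlt, st', l', y', rfl, h'⟩
  · rintro t₂ s₂ ⟨ht₂, hb, f, st, l, y, -, h⟩
    simp only [BExpr.Holds, NExpr.eval, h.m_eq, h.a_eq] at hb
    refine ⟨?_, st, l, y, h, le_antisymm (by omega) h.le⟩
    simp only [BExpr.cost, NExpr.cost] at ht₂
    nlinarith

/-! ### The pruning phase -/

/-- Set register `12` to `1` if a vertex recorded from the cell in register `4` on is touched. -/
def touchCmd : Cmd :=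
  .loop 14 (.ite (.natLe (.const 2) (.add (.get 12 (.add (.var 4) (.var 14))) (.get 6 (.var 14))))
    (.setN 12 (.const 1)) .skip)

theorem wp_touchCmd (h0 : s.ivar 0 = n) :
    wp touchCmd (fun t s' => t ≤ (n + 1) * 30 + 2 ∧ s'.iarr = s.iarr ∧
      (∀ r, r ≠ 12 → r ≠ 14 → s'.ivar r = s.ivar r) ∧
      (1 ≤ s'.ivar 12 ↔ 1 ≤ s.ivar 12 ∨
        ∃ x < n, 2 ≤ s.iarr 12 (s.ivar 4 + x) + s.iarr 6 x)) s := by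
  refine wp_mono (wp_loop (n := n) (T := 20) (Inv := fun k s' => s'.iarr = s.iarr ∧
      (∀ r, r ≠ 12 → r ≠ 14 → s'.ivar r = s.ivar r) ∧ s'.ivar 14 = k ∧
      (1 ≤ s'.ivar 12 ↔ 1 ≤ s.ivar 12 ∨
        ∃ x < k, 2 ≤ s.iarr 12 (s.ivar 4 + x) + s.iarr 6 x)) ?_ ?_ ?_) ?_
  · refine ⟨rfl, fun r _ r14 => ?_, ?_, ?_⟩
    · simp [Mem.setN_ivar, r14]
    · simp [Mem.setN_ivar]
    · simp [Mem.setN_ivar]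
  · rintro k s' ⟨-, h1, h2, -⟩
    exact ⟨(h1 0 (by simp) (by simp)).trans h0, h2⟩
  · rintro k hk s' ⟨h1, h2, h3, h4⟩
    have e4 := h2 4 (by simp) (by simp)
    simp only [wp_ite, wp_setN, wp_skip, BExpr.Holds, NExpr.eval, BExpr.cost, NExpr.cost, h1, h3,
      e4]
    refine ⟨fun hc => ⟨by norm_num, ?_, h1, fun r r12 r14 => ?_, ?_, ?_⟩,
      fun hc => ⟨by norm_num, trivial, h1, fun r r12 r14 => ?_, ?_, ?_⟩⟩
    · simp [Mem.setN_ivar, h3]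
    · simp [Mem.setN_ivar, r12, r14, h2]
    · simp [Mem.setN_ivar]
    · simp only [Mem.setN_ivar]
      simp +decide only [ne_eq, Function.update_of_ne, Function.update_self, le_refl, true_iff]
      exact .inr ⟨k, by omega, hc⟩
    · simp [Mem.setN_ivar, r12, r14, h2]
    · simp [Mem.setN_ivar]
    · simp only [Mem.setN_ivar]
      simp +decide only [ne_eq, Function.update_of_ne, h4]
      refine or_congr Iff.rfl ⟨fun ⟨x, hx, h⟩ => ⟨x, by omega, h⟩, fun ⟨x, hx, h⟩ => ⟨x, ?_, h⟩⟩
      rcases Nat.lt_succ_iff_lt_or_eq.1 hx with hx | rfl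
      · exact hx
      · exact absurd h hc
  · rintro t s' ⟨ht, h1, h2, -, h4⟩
    exact ⟨ht, h1, h2, h4⟩

/-- Keep the edge of the merge with the index in register `3`. -/
def keepCmd : Cmd :=
  .seq (.putN 5 (.var 11) (.const 1)) (.seq (.putN 6 (.get 7 (.var 3)) (.const 1))
  (.seq (.putN 6 (.get 8 (.var 3)) (.const 1)) (.seq (.setN 12 (.get 4 (.get 7 (.var 3))))
  (.seq (.putN 4 (.get 7 (.var 3)) (.get 4 (.get 8 (.var 3))))
  (.putN 4 (.get 8 (.var 3)) (.var 12))))))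

/-- Undo a merge. -/
def pruneBody : Cmd :=
  .seq (.setN 3 (.sub (.var 3) (.const 1))) (.seq (.setN 4 (.sub (.var 4) (.var 0)))
  (.seq (.setN 10 (.get 9 (.var 3))) (.seq (.setN 11 (.get 10 (.var 3)))
  (.ite (.natLe (.get 3 (.var 10)) (.get 5 (.var 10)))
    (.seq (.setN 12 (.sub (.const 1) (.get 11 (.var 3))))
      (.seq touchCmd (.ite (.natLe (.const 1) (.var 12)) keepCmd .skip)))
    .skip))))

open Classical in
/-- The invariant of the pruning phase. -/
structure Back (I : Inst (Fin n)) (m : ℕ) (labE : Fin n → Fin n) (A : Finset (Fin n)) (yE : ℝ)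
    (l : List (Fin n × Fin n × Moat (Fin n))) (st : Moat (Fin n)) (y : ℝ) (K : Finset (Fin n))
    (F : List (Fin n × Fin n)) (σ : Equiv.Perm (Fin n)) (s : Mem) : Prop where
  hist : Moat.Hist I m l st y
  tail : Moat.Tail I m labE A st (yE - y) K F σ
  log : Log l s.iarr
  n_eq : s.ivar 0 = n
  k_eq : s.ivar 3 = l.length
  q_eq : s.ivar 4 = l.length * n
  dead : ∀ x : Fin n, s.iarr 3 x = if x ∈ A then 0 else 1
  -- Array `3` keeps the flags from the end of growth. A label is kept if it was active then or has
  -- been marked in array `5`, so an all-zero array `5` encodes the initial `K`.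
  kept : ∀ x : Fin n, s.iarr 3 x ≤ s.iarr 5 x ↔ x ∈ K
  nxt : ∀ x : Fin n, s.iarr 4 x = σ x
  touched : ∀ x : Fin n, s.iarr 6 x = if Moat.Touched F x then 1 else 0

theorem wp_pruneBody {labE : Fin n → Fin n} {A : Finset (Fin n)} {yE : ℝ}
    {e : Fin n × Fin n × Moat (Fin n)} {l : List (Fin n × Fin n × Moat (Fin n))}
    {y : ℝ} {K : Finset (Fin n)} {F : List (Fin n × Fin n)} {σ : Equiv.Perm (Fin n)}
    (h : Back I m labE A yE (e :: l) st y K F σ s) :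
    wp pruneBody (fun t s' => t ≤ (n + 1) * 30 + 70 ∧ ∃ st' y' K' F' σ',
      Back I m labE A yE l st' y' K' F' σ' s') s := by
  classical
  obtain ⟨u, v, st'⟩ := e
  obtain ⟨y', hist, good, huv, hact, hw, tail⟩ := h.hist.rewind rfl h.tail
  obtain ⟨g7, g8, g9, g10, g11, g12, log⟩ := h.log
  have hk : s.ivar 3 - 1 = l.length := by rw [h.k_eq]; simp
  have hq : s.ivar 4 - n = l.length * n := by
    rw [h.q_eq, List.length_cons, add_mul]
    omega
  simp only [pruneBody, wp_seq, wp_setN, NExpr.eval, NExpr.cost]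
  set s₁ := (((s.setN 3 (s.ivar 3 - 1)).setN 4
    ((s.setN 3 (s.ivar 3 - 1)).ivar 4 - (s.setN 3 (s.ivar 3 - 1)).ivar 0)) : Mem) with hs₁
  have k3 : s₁.ivar 3 = l.length := by simpa [hs₁, Mem.setN_ivar] using hk
  have k4 : s₁.ivar 4 = l.length * n := by simpa [hs₁, Mem.setN_ivar, h.n_eq] using hq
  have k0 : s₁.ivar 0 = n := by simpa [hs₁, Mem.setN_ivar] using h.n_eq
  have kA : s₁.iarr = s.iarr := rfl
  simp only [Mem.setN_iarr, Mem.setN_ivar, kA, k3, g9]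
  simp +decide only [Function.update_of_ne, ne_eq, k3, g10]
  set s₂ := (s₁.setN 10 (st'.lab u)).setN 11 (st'.lab v) with hs₂
  have j0 : s₂.ivar 0 = n := by simpa [hs₂, Mem.setN_ivar] using k0
  have j3 : s₂.ivar 3 = l.length := by simpa [hs₂, Mem.setN_ivar] using k3
  have j4 : s₂.ivar 4 = l.length * n := by simpa [hs₂, Mem.setN_ivar] using k4
  have j10 : s₂.ivar 10 = st'.lab u := by simp [hs₂, Mem.setN_ivar]
  have j11 : s₂.ivar 11 = st'.lab v := by simp [hs₂, Mem.setN_ivar]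
  have jA : s₂.iarr = s.iarr := rfl
  have drop : ∀ s' : Mem, s'.iarr = s.iarr → s'.ivar 0 = n → s'.ivar 3 = l.length →
      s'.ivar 4 = l.length * n →
      (st'.lab u ∉ K ∨ st'.lab v ∉ st'.act ∧ ∀ x, st'.lab x = st'.lab v → ¬ Moat.Touched F x) →
      Back I m labE A yE l st' y' K F σ s' := fun s' a1 a2 a3 a4 a5 =>
    ⟨hist, tail.of_merge_drop good huv hact a5, a1 ▸ log, a2, a3, a4, a1 ▸ h.dead, a1 ▸ h.kept,
      a1 ▸ h.nxt, a1 ▸ h.touched⟩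
  simp only [wp_ite, BExpr.Holds, NExpr.eval, j10, jA, h.kept, BExpr.cost, NExpr.cost]
  refine ⟨fun hK => ?_, fun hK => ?_⟩
  · simp only [wp_seq, wp_setN, NExpr.eval, NExpr.cost, jA, j3, g11]
    set s₃ := s₂.setN 12 (1 - if st'.lab v ∈ st'.act then 0 else 1) with hs₃
    have i0 : s₃.ivar 0 = n := by simpa [hs₃, Mem.setN_ivar] using j0
    have i4 : s₃.ivar 4 = l.length * n := by simpa [hs₃, Mem.setN_ivar] using j4
    have i12 : 1 ≤ s₃.ivar 12 ↔ st'.lab v ∈ st'.act := by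
      by_cases hv : st'.lab v ∈ st'.act <;> simp [hs₃, Mem.setN_ivar, hv]
    have iA : s₃.iarr = s.iarr := rfl
    refine wp_mono (wp_touchCmd i0) ?_
    rintro t s₄ ⟨ht, f1, f2, f3⟩
    have f0 : s₄.ivar 0 = n := (f2 0 (by simp) (by simp)).trans i0
    have f4 : s₄.ivar 4 = l.length * n := (f2 4 (by simp) (by simp)).trans i4
    have f5 : s₄.ivar 3 = l.length :=
      (f2 3 (by simp) (by simp)).trans (by simpa [hs₃, Mem.setN_ivar] using j3)
    have f11 : s₄.ivar 11 = st'.lab v :=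
      (f2 11 (by simp) (by simp)).trans (by simpa [hs₃, Mem.setN_ivar] using j11)
    have fA : s₄.iarr = s.iarr := f1.trans iA
    -- Both summands in `f3` are 0 or 1, so a sum of 2 means a touched vertex in the component of
    -- `v`. Register `12` starts at 1 exactly if this component was active before the merge.
    have htouch : 1 ≤ s₄.ivar 12 ↔
        st'.lab v ∈ st'.act ∨ ∃ x, st'.lab x = st'.lab v ∧ Moat.Touched F x := by
      rw [f3, i12, i4, iA]
      refine or_congr Iff.rfl ⟨fun ⟨x, hx, h2⟩ => ⟨⟨x, hx⟩, ?_⟩, fun ⟨x, h1, h2⟩ => ⟨x, x.isLt, ?_⟩⟩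
      · have a1 := g12 ⟨x, hx⟩
        have a2 := h.touched ⟨x, hx⟩
        simp only at a1 a2
        rw [a1, a2] at h2
        by_cases b1 : st'.lab ⟨x, hx⟩ = st'.lab v <;> by_cases b2 : Moat.Touched F ⟨x, hx⟩ <;>
          simp [b1, b2] at h2 ⊢
      · rw [g12, h.touched]
        simp [h1, h2]
    simp only [wp_ite, BExpr.Holds, NExpr.eval, htouch, BExpr.cost, NExpr.cost]
    refine ⟨fun hc => ?_, fun hc => ?_⟩
    · simp only [keepCmd, wp_seq, wp_putN, wp_setN, NExpr.eval, NExpr.cost, Mem.putN_ivar,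
        Mem.putN_iarr, Mem.setN_ivar, Mem.setN_iarr, fA, f5, f11]
      simp +decide only [Function.update_of_ne, Function.update_self, ne_eq, g7, g8, h.nxt, f5]
      have hne : u ≠ v := fun e => huv (e ▸ rfl)
      have hne' : (v : ℕ) ≠ u := fun e => hne (Fin.ext e.symm)
      refine ⟨by omega, st', y', _, _, _, hist, tail.of_merge_keep good huv hact hw hK hc,
        log.congr (fun a a1 a2 k hk => ?_) (fun k hk => ?_), ?_, ?_, ?_, fun x => ?_, fun x => ?_,
        fun x => ?_, fun x => ?_⟩
      · have a4 : a ≠ 4 := by omega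
        have a5 : a ≠ 5 := by omega
        have a6 : a ≠ 6 := by omega
        simp [Mem.putN_iarr, Mem.setN_iarr, a4, a5, a6, fA]
      · simp [Mem.putN_iarr, Mem.setN_iarr, fA]
      · simpa [Mem.putN_ivar, Mem.setN_ivar] using f0
      · simpa [Mem.putN_ivar, Mem.setN_ivar] using f5
      · simpa [Mem.putN_ivar, Mem.setN_ivar] using f4
      · simpa [Mem.putN_iarr, Mem.setN_iarr, fA] using h.dead x
      · simp +decide only [Mem.putN_iarr, Mem.setN_iarr, fA, Function.update_of_ne,
          Function.update_self, ne_eq]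
        rw [mem_insert, Function.update_apply]
        by_cases hx : x = st'.lab v
        · simp only [hx, if_true, true_or, iff_true, h.dead]
          split_ifs <;> simp
        · have hx' : (x : ℕ) ≠ st'.lab v := fun e => hx (Fin.ext e)
          simp [hx, hx', h.kept]
      · simp +decide only [Mem.putN_iarr, Mem.setN_iarr, fA, Function.update_of_ne,
          Function.update_self, ne_eq]
        -- Multiplying by the transposition on the right exchanges the successors of `u` and `v`.
        rw [Equiv.Perm.mul_apply]
        by_cases h1 : x = v
        · subst h1
          simp
        · have h1' : (x : ℕ) ≠ v := fun e => h1 (Fin.ext e)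
          by_cases h2 : x = u
          · subst h2
            simp [h1']
          · have h2' : (x : ℕ) ≠ u := fun e => h2 (Fin.ext e)
            simp [h1', h2', Equiv.swap_apply_of_ne_of_ne h2 h1, h.nxt]
      · simp +decide only [Mem.putN_iarr, Mem.setN_iarr, fA, Function.update_of_ne,
          Function.update_self, ne_eq]
        have ht : Moat.Touched ((u, v) :: F) x ↔ x = u ∨ x = v ∨ Moat.Touched F x := by
          simp [Moat.Touched, or_assoc]
        simp only [Function.update_apply, Fin.val_inj, h.touched, ht]
        by_cases h1 : x = v <;> by_cases h2 : x = u <;> simp [h1, h2]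
    · rw [wp_skip]
      refine ⟨by omega, st', y', _, _, _, drop s₄ fA f0 f5 f4 (.inr ?_)⟩
      push Not at hc
      exact hc
  · rw [wp_skip]
    exact ⟨by omega, st', y', _, _, _, drop s₂ jA j0 j3 j4 (.inl hK)⟩

/-- Undo all merges. -/
def pruneCmd : Cmd := .while (.natLe (.const 1) (.var 3)) pruneBody

theorem wp_pruneCmd {l : List (Fin n × Fin n × Moat (Fin n))} {y : ℝ} (h : Fwd I m st l y s)
    (hm : st.act.card = m) :
    wp pruneCmd (fun t s' => t ≤ (l.length + 1) * ((n + 1) * 30 + 80) ∧ s'.ivar 0 = n ∧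
      (∀ x : Fin n, s'.iarr 3 x = if x ∈ st.act then 0 else 1) ∧ ∃ K F σ,
      Moat.Tail I m st.lab st.act (Moat.init I) y K F σ ∧ ∀ x : Fin n, s'.iarr 4 x = σ x) s := by
  classical
  refine wp_mono (wp_while (Inv := fun f s' => ∃ l' st' y' K F σ, l'.length = f ∧
    Back I m st.lab st.act y l' st' y' K F σ s') (T := (n + 1) * 30 + 70) (f := l.length)
    ⟨l, st, y, st.act, [], 1, rfl, h.hist, by simpa using h.good.tail hm, h.log, h.rep.n_eq,
      h.k_eq, h.q_eq, h.rep.dead, fun x => ?_, h.nxt, fun x => ?_⟩ ?_) ?_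
  · rw [h.kept, h.rep.dead]
    by_cases hx : x ∈ st.act <;> simp [hx]
  · simp [h.touched, Moat.Touched]
  · rintro f s' ⟨l', st', y', K, F, σ, rfl, hb⟩ hc
    simp only [BExpr.Holds, NExpr.eval, hb.k_eq] at hc
    cases l' with
    | nil => simp at hc
    | cons e l' =>
      refine wp_mono (wp_pruneBody hb) ?_
      rintro t s'' ⟨ht, st'', y'', K', F', σ', hb'⟩
      exact ⟨ht, l'.length, by simp, l', st'', y'', K', F', σ', rfl, hb'⟩
  · rintro t s' ⟨ht, hc, f, l', st', y', K, F, σ, -, hb⟩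
    simp only [BExpr.Holds, NExpr.eval, hb.k_eq] at hc
    -- With no merge left, the events before the first merge are undone by `rewind_nil`.
    have hl : l' = [] := List.length_eq_zero_iff.1 (by omega)
    refine ⟨?_, hb.n_eq, hb.dead, K, F, σ, hb.hist.rewind_nil hl hb.tail, hb.nxt⟩
    simp only [BExpr.cost, NExpr.cost] at ht
    nlinarith

/-! ### The output -/

/-- Output the cycle of the vertex in register `5` as the path with the index in register `15`. -/
def pathCmd : Cmd :=
  .seq (.putN 1 (.var 16) (.var 5)) (.seq (.setN 17 (.const 1)) (.seq (.setN 18 (.get 4 (.var 5)))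
  (.seq (.while (.not (.natEq (.var 18) (.var 5)))
    (.seq (.putN 1 (.add (.var 16) (.var 17)) (.var 18))
      (.seq (.setN 17 (.add (.var 17) (.const 1))) (.setN 18 (.get 4 (.var 18))))))
  (.seq (.putN 0 (.var 15) (.var 17)) (.seq (.setN 15 (.add (.var 15) (.const 1)))
    (.setN 16 (.add (.var 16) (.var 0))))))))

open Function in
theorem minimalPeriod_le_card (σ : Equiv.Perm (Fin n)) (c : Fin n) : minimalPeriod σ c ≤ n := by
  have := (nodup_cycleList σ c).length_le_card
  simpa [cycleList] using this

open Function in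
-- The start vertex is written before the loop, so `i` begins at 1 and the loop counter at the
-- period minus 1. On exit the walk is back at `c` with `1 ≤ i`, which forces `i` to be the minimal
-- period.
theorem wp_pathCmd {σ : Equiv.Perm (Fin n)} {c : Fin n} {j q : ℕ} (h0 : s.ivar 0 = n)
    (hσ : ∀ x : Fin n, s.iarr 4 x = σ x) (h5 : s.ivar 5 = c) (h15 : s.ivar 15 = j)
    (h16 : s.ivar 16 = q) :
    wp pathCmd (fun t s' => t ≤ (n + 1) * 30 + 30 ∧
      (s'.iarr 0 = update (s.iarr 0) j (minimalPeriod σ c)) ∧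
      (∀ i < minimalPeriod σ c, s'.iarr 1 (q + i) = (σ^[i] c : Fin n)) ∧
      (∀ k < q, s'.iarr 1 k = s.iarr 1 k) ∧ (∀ a, 2 ≤ a → s'.iarr a = s.iarr a) ∧
      s'.ivar 15 = j + 1 ∧ s'.ivar 16 = q + n ∧ ∀ r < 15, s'.ivar r = s.ivar r) s := by
  have hpos := minimalPeriod_perm_pos σ c
  have hle := minimalPeriod_le_card σ c
  simp only [pathCmd, wp_seq, wp_putN, wp_setN, NExpr.eval, NExpr.cost, h5, h16]
  refine wp_mono (wp_while (f := minimalPeriod σ c - 1) (T := 20)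
    (Inv := fun f s' => ∃ i, 1 ≤ i ∧ f + i = minimalPeriod σ c ∧ s'.ivar 17 = i ∧
      s'.ivar 18 = (σ^[i] c : Fin n) ∧ (∀ i' < i, s'.iarr 1 (q + i') = (σ^[i'] c : Fin n)) ∧
      (∀ k < q, s'.iarr 1 k = s.iarr 1 k) ∧ (∀ a, a ≠ 1 → s'.iarr a = s.iarr a) ∧
      ∀ r < 17, s'.ivar r = s.ivar r) ⟨1, le_rfl, by omega, ?_, ?_, ?_, ?_, ?_, ?_⟩ ?_) ?_
  · simp [Mem.setN_ivar]
  · simp [Mem.setN_ivar, Mem.setN_iarr, Mem.putN_iarr, Mem.putN_ivar, h5, hσ]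
  · intro i hi
    have : i = 0 := by omega
    simp [Mem.setN_iarr, Mem.putN_iarr, this]
  · intro k hk
    simp [Mem.setN_iarr, Mem.putN_iarr, hk.ne]
  · intro a ha
    simp [Mem.setN_iarr, Mem.putN_iarr, ha]
  · intro r hr
    have r17 : r ≠ 17 := by omega
    have r18 : r ≠ 18 := by omega
    simp [Mem.setN_ivar, Mem.putN_ivar, r17, r18]
  · rintro f s' ⟨i, hi, hf, g17, g18, g1, g2, g3, g4⟩ hb
    simp only [BExpr.Holds, BExpr.natEq_holds, NExpr.eval, g18, g4 5 (by simp), h5,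
      Fin.val_inj] at hb
    have hlt : f ≠ 0 := by
      rintro rfl
      rw [zero_add] at hf
      subst hf
      exact hb iterate_minimalPeriod
    simp only [wp_seq, wp_putN, wp_setN, NExpr.eval, NExpr.cost, g17, g18, g4 16 (by simp), h16]
    refine ⟨by norm_num, f - 1, by omega, i + 1, by omega, by omega, ?_, ?_, fun i' hi' => ?_,
      fun k hk => ?_, fun a ha => ?_, fun r hr => ?_⟩
    · simp [Mem.setN_ivar, Mem.putN_ivar, g17]
    · simp [Mem.setN_ivar, Mem.setN_iarr, Mem.putN_iarr, Mem.putN_ivar, g18, g3, hσ,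
        iterate_succ_apply']
    · by_cases e : i' = i
      · simp [Mem.setN_iarr, Mem.putN_iarr, e]
      · simp [Mem.setN_iarr, Mem.putN_iarr, e, g1 i' (by omega)]
    · have : k ≠ q + i := by omega
      simp [Mem.setN_iarr, Mem.putN_iarr, this, g2 k hk]
    · simp [Mem.setN_iarr, Mem.putN_iarr, ha, g3]
    · have r17 : r ≠ 17 := by omega
      have r18 : r ≠ 18 := by omega
      simp [Mem.setN_ivar, Mem.putN_ivar, r17, r18, g4 r hr]
  · rintro t s' ⟨ht, hb, f, i, hi, hf, g17, g18, g1, g2, g3, g4⟩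
    simp only [BExpr.Holds, BExpr.natEq_holds, NExpr.eval, g18, g4 5 (by simp), h5,
      Fin.val_inj, not_not] at hb
    have hge := IsPeriodicPt.minimalPeriod_le (by omega) hb
    have hi' : i = minimalPeriod σ c := by omega
    subst hi'
    refine ⟨?_, ?_, fun i hi => ?_, fun k hk => ?_, fun a ha => ?_, ?_, ?_, fun r hr => ?_⟩
    · simp only [BExpr.cost, BExpr.natEq_cost, NExpr.cost] at ht
      have : minimalPeriod σ c - 1 + 1 ≤ n + 1 := by omega
      have h3 := Nat.mul_le_mul_right (20 + (1 + 1 + 1 + (1 + 1 + 1) + 1 + 1) + 1) this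
      omega
    · simp [Mem.setN_iarr, Mem.putN_iarr, g17, g3, g4, h15]
    · simp [Mem.setN_iarr, Mem.putN_iarr, g1 i hi]
    · simp [Mem.setN_iarr, Mem.putN_iarr, g2 k hk]
    · have a0 : a ≠ 0 := by omega
      simp [Mem.setN_iarr, Mem.putN_iarr, a0, g3 a (by omega)]
    · simp [Mem.setN_ivar, Mem.putN_ivar, g4, h15]
    · simp [Mem.setN_ivar, Mem.putN_ivar, g4, h16, h0]
    · have r15 : r ≠ 15 := by omega
      have r16 : r ≠ 16 := by omega
      simp [Mem.setN_ivar, Mem.putN_ivar, r15, r16, g4 r (by omega)]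

/-- Output the cycles of the labels of the active components. -/
def outCmd : Cmd :=
  .seq (.setN 15 (.const 0)) (.seq (.setN 16 (.const 0))
    (.loop 5 (.ite (.natLe (.get 3 (.var 5)) (.const 0)) pathCmd .skip)))

open Function in
-- The list `cs` collects the active labels met so far; its `j`-th entry is the start of the `j`-th
-- path.
theorem wp_outCmd {σ : Equiv.Perm (Fin n)} {A : Finset (Fin n)} (h0 : s.ivar 0 = n)
    (hσ : ∀ x : Fin n, s.iarr 4 x = σ x)
    (hA : ∀ x : Fin n, s.iarr 3 x = if x ∈ A then 0 else 1) :
    wp outCmd (fun t s' => t ≤ (n + 1) * ((n + 1) * 30 + 60) + 6 ∧ ∃ cs : List (Fin n),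
      cs.Nodup ∧ (∀ c, c ∈ cs ↔ c ∈ A) ∧ ∀ (j : ℕ) (hj : j < cs.length),
        s'.iarr 0 j = minimalPeriod σ cs[j] ∧
        ∀ i < minimalPeriod σ cs[j], s'.iarr 1 (j * n + i) = (σ^[i] cs[j] : Fin n)) s := by
  rw [outCmd, wp_seq, wp_setN, wp_seq, wp_setN]
  simp only [NExpr.eval, NExpr.cost]
  refine wp_mono (wp_loop (n := n) (T := (n + 1) * 30 + 50) (Inv := fun k s' =>
    s'.ivar 0 = n ∧ s'.ivar 5 = k ∧ (∀ a, 2 ≤ a → s'.iarr a = s.iarr a) ∧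
    ∃ cs : List (Fin n), s'.ivar 15 = cs.length ∧ s'.ivar 16 = cs.length * n ∧
      cs.Nodup ∧ (∀ c : Fin n, c ∈ cs ↔ c ∈ A ∧ c.val < k) ∧ ∀ (j : ℕ) (hj : j < cs.length),
        s'.iarr 0 j = minimalPeriod σ cs[j] ∧
        ∀ i < minimalPeriod σ cs[j], s'.iarr 1 (j * n + i) = (σ^[i] cs[j] : Fin n))
    ?_ ?_ ?_) ?_
  · refine ⟨?_, ?_, fun _ _ => rfl, [], ?_, ?_, by simp, by simp, by simp⟩ <;>
      simp [Mem.setN_ivar, h0]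
  · rintro k s' ⟨h1, h2, -⟩
    exact ⟨h1, h2⟩
  · rintro k hk s' ⟨h1, h2, h3, cs, g1, g2, g3, g4, g5⟩
    have e3 : s'.iarr 3 k = if (⟨k, hk⟩ : Fin n) ∈ A then 0 else 1 := by
      rw [h3 3 (by simp)]
      exact hA ⟨k, hk⟩
    have hcond : s'.iarr 3 k ≤ 0 ↔ (⟨k, hk⟩ : Fin n) ∈ A := by
      rw [e3]
      by_cases ha : (⟨k, hk⟩ : Fin n) ∈ A <;> simp [ha]
    simp only [wp_ite, BExpr.Holds, NExpr.eval, h2, hcond, BExpr.cost, NExpr.cost]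
    refine ⟨fun ha => ?_, fun ha => ?_⟩
    · refine wp_mono (wp_pathCmd (σ := σ) (c := ⟨k, hk⟩) h1 ?_ h2 g1 g2) ?_
      · rw [h3 4 (by simp)]
        exact hσ
      rintro t s'' ⟨ht, f1, f2, f3, f4, f5, f6, f7⟩
      refine ⟨by omega, (f7 5 (by simp)).trans h2, ?_, ?_, fun a ha => ?_, cs ++ [⟨k, hk⟩],
        ?_, ?_, ?_, fun c => ?_, fun j hj => ?_⟩
      · simpa [Mem.setN_ivar, f7] using h1
      · simp [Mem.setN_ivar]
      · rw [Mem.setN_iarr, f4 a ha, h3 a ha]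
      · simp [Mem.setN_ivar, f5]
      · simp [Mem.setN_ivar, f6, add_mul]
      · rw [List.nodup_append_comm, List.singleton_append, List.nodup_cons]
        refine ⟨fun hmem => ?_, g3⟩
        have := ((g4 _).1 hmem).2
        simp at this
      · rw [List.mem_append, g4, List.mem_singleton, Fin.ext_iff]
        constructor
        · rintro (h | h)
          · exact ⟨h.1, by omega⟩
          · have : c = ⟨k, hk⟩ := Fin.ext h
            exact ⟨this ▸ ha, by rw [this]; exact Nat.lt_succ_self k⟩
        · rintro ⟨h, hlt⟩
          by_cases e : c.val = k
          · exact .inr e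
          · exact .inl ⟨h, by omega⟩
      · rw [Mem.setN_iarr, f1]
        rw [List.length_append, List.length_singleton] at hj
        by_cases e : j = cs.length
        · subst e
          simpa using f2
        · have hj' : j < cs.length := by omega
          rw [update_of_ne e, List.getElem_append_left hj']
          refine ⟨(g5 j hj').1, fun i hi => ?_⟩
          rw [f3 _ ?_, (g5 j hj').2 i hi]
          -- A cycle has at most `n` vertices, so an earlier block ends before the new one begins.
          have h8 : i < n := hi.trans_le (minimalPeriod_le_card _ _)
          have h9 : (j + 1) * n ≤ cs.length * n := Nat.mul_le_mul_right _ hj'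
          rw [add_mul] at h9
          omega
    · rw [wp_skip]
      refine ⟨by omega, h2, ?_, ?_, h3, cs, ?_, ?_, g3, fun c => ?_, g5⟩
      · simpa [Mem.setN_ivar] using h1
      · simp [Mem.setN_ivar]
      · simpa [Mem.setN_ivar] using g1
      · simpa [Mem.setN_ivar] using g2
      · rw [g4]
        constructor
        · exact fun h => ⟨h.1, by omega⟩
        · rintro ⟨h, hlt⟩
          refine ⟨h, ?_⟩
          by_contra hcon
          have : c = ⟨k, hk⟩ := Fin.ext (by simp; omega)
          exact ha (this ▸ h)
  · rintro t s' ⟨ht, -, -, -, cs, -, -, g3, g4, g5⟩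
    refine ⟨?_, cs, g3, fun c => by simp [g4, c.isLt], g5⟩
    have : (n + 1) * ((n + 1) * 30 + 50 + 10) = (n + 1) * ((n + 1) * 30 + 60) := rfl
    omega

/-! ### The algorithm -/

/-- Every merge destroys one of the initial `n` labels. This bounds the number of pruning steps. -/
theorem Moat.Hist.length_le {l : List (Fin n × Fin n × Moat (Fin n))} {y : ℝ}
    (h : Moat.Hist I m l st y) : l.length + (univ.filter fun c => st.lab c = c).card ≤ n := by
  induction h with
  | init => simp [Moat.init]
  | grow _ _ _ ih => exact ih
  | kill _ _ ih => exact ih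
  | merge _ hs huv _ _ ih =>
    have := Moat.card_labels_merge hs huv
    rw [List.length_cons]
    omega

/-- Moat growing, pruning, and output of the tours. -/
def lmpCmd : Cmd := .seq phaseCmd (.seq pruneCmd outCmd)

theorem wp_lmpCmd (I : Inst (Fin n)) (h1 : 1 ≤ m) (hm : m ≤ n) :
    wp lmpCmd (fun t s => t ≤ 10000 * n ^ 4 ∧ ∃ T : PathFamily (Fin n) m, Outputs s T ∧
      I.weight T + 4 * I.uncovered T ≤ 4 * I.opt m) (loadMem I m) := by
  rw [lmpCmd, wp_seq]
  refine wp_mono (wp_phaseCmd (I := I) hm) ?_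
  rintro t₁ s₁ ⟨ht₁, st, l, y, hf, hcard⟩
  rw [wp_seq]
  refine wp_mono (wp_pruneCmd hf hcard) ?_
  rintro t₂ s₂ ⟨ht₂, h0, hdead, K, F, σ, htail, hσ⟩
  refine wp_mono (wp_outCmd h0 hσ hdead) ?_
  rintro t₃ s₃ ⟨ht₃, cs, hnd, hcs, hout⟩
  have hlen : cs.length = m := by
    rw [← hcard, ← List.toFinset_card_of_nodup hnd]
    congr 1
    ext c
    rw [List.mem_toFinset, hcs]
  refine ⟨?_, ?_⟩
  · have hl : l.length ≤ n := by
      have := hf.hist.length_le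
      omega
    have h2 : (l.length + 1) * ((n + 1) * 30 + 80) ≤ (n + 1) * ((n + 1) * 30 + 80) :=
      Nat.mul_le_mul_right _ (by omega)
    have hn : 1 ≤ n := h1.trans hm
    have p1 : 1 ≤ n ^ 4 := Nat.one_le_pow _ _ hn
    have p2 : n ≤ n ^ 4 := Nat.le_self_pow (by simp) n
    have p3 : n ^ 2 ≤ n ^ 4 := Nat.pow_le_pow_right hn (by simp)
    have p4 : n ^ 3 ≤ n ^ 4 := Nat.pow_le_pow_right hn (by simp)
    -- The growth phase dominates and is only cubic; as `1 ≤ n`, all lower powers are absorbed by `n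
    -- ^ 4`.
    have e1 : (2 * n + 2) * ((n + 1) * ((n + 1) * 110 + 100) + 120) =
        220 * n ^ 3 + 860 * n ^ 2 + 1300 * n + 660 := by ring
    have e2 : (n + 1) * ((n + 1) * 30 + 80) = 30 * n ^ 2 + 140 * n + 110 := by ring
    have e3 : (n + 1) * ((n + 1) * 30 + 60) = 30 * n ^ 2 + 120 * n + 90 := by ring
    omega
  · obtain ⟨T, hT, hw⟩ := htail.exists_family hf.good.lab_act hcard
      (fun j : Fin m => cs[j.val]'(by omega))
      (fun i j hij => Fin.ext ((hnd.getElem_inj_iff).1 hij))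
      (fun j => (hcs _).1 (List.getElem_mem _))
    refine ⟨T, fun j => ?_, ?_⟩
    · have hj := hout j.val (by omega)
      rw [hT, cycleList, List.map_map, hj.1]
      refine List.map_congr_left fun i hi => ?_
      rw [hj.2 i (List.mem_range.1 hi)]
      rfl
    -- The infimum is attained, so it suffices to bound the cost of one optimal family from below.
    · have hopt : y ≤ I.opt m := by
        obtain ⟨⟨T', hT'⟩, -⟩ := isLeast_opt I (m := m) (by simpa using hm)
        rw [← hT']
        exact (hf.hist.le_lower T').trans (Moat.lower_le_cost hf.good T')
      linarith

end PrizeCollecting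

theorem mainTheorem4 :
    ∃ A : PrizeCollecting.Cmd,
      PrizeCollecting.IsLMP 4 A ∧ PrizeCollecting.RunsInTime A (fun n => n ^ 4) := by
  refine ⟨PrizeCollecting.lmpCmd,
    ⟨Polynomial.C 10000 * Polynomial.X ^ 4, fun n m h1 hm I => ?_⟩,
    ⟨10000, fun n m h1 hm I => ?_⟩⟩
  · obtain ⟨t, s, he, ht, T, hT, hw⟩ := PrizeCollecting.wp_lmpCmd I h1 hm
    exact ⟨t, T, ⟨s, he, hT⟩, by simpa using ht, hw⟩
  · obtain ⟨t, s, he, ht, -⟩ := PrizeCollecting.wp_lmpCmd I h1 hm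
    exact ⟨t, s, he, ht⟩
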